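/- Let $n\ge 2$. There exist constants $c_n\in(0,1)$ and $\tilde c_n>0$, depending only on $n$, such that the following holds for every open set $\Omega\subset\mathbb R^n$, every real vector field $a\in L^2_{loc}(\Omega)$ and every real function $V\in L^1_{loc}(\Omega)$ with $V\ge 0$. Put $\nabla_a u=\nabla u+iau$ and let $H_{a,V}$ be the operator in $L^2(\Omega)$ (Dirichlet boundary conditions) defined by the closure of the quadratic form $h_{a,V}(u,u)=\int_\Omega(|\nabla_a u|^2+V|u|^2)\,dx$, $u\in C_c^\infty(\Omega)$. Let $Q_d$ denote a closed cube with edges of length $d>0$ parallel to the coordinate axes. For an open $U$ and a compact $F\subset U$ let $\mathrm{cap}_U(F)$ be the infimum of $\int_{\mathbb R^n}|\nabla u|^2dx$ over the complex-valued Lipschitz functions $u$ with compact support in $U$ and $u|_F=1$. For a compact $F\subset Q_d$ let $\mathrm{cap}(F)=\mathrm{cap}_{\mathbb R^n}(F)$ if $n\ge 3$, and let $\mathrm{cap}(F)$ be the capacity relative to the interior of the concentric square $Q_{2d}$ if $n=2$. For $0<\gamma<1$ put $$M_{\gamma,\Omega}(Q_d;V)=\inf_F\Big\{\int_{Q_d\setminus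 F}V\,dx \;:\; F\subset Q_d \text{ closed},\ \mathrm{cap}(F)\le\gamma\,\mathrm{cap}(Q_d),\ F\supset Q_d\cap(\mathbb R^n\setminus\Omega)\Big\},$$ $$\mu_{0,\Omega}(Q_d)=\inf_u\frac{\int_{Q_d}|\nabla_a u|^2dx}{\int_{Q_d}|u|^2dx},$$ where $u$ runs over the complex-valued functions that are $C^\infty$ on the closed cube $Q_d$, not identically zero, and vanish in a neighborhood of $Q_d\cap(\mathbb R^n\setminus\Omega)$. (Both infima are $+\infty$ if there is no admissible $F$, respectively $u$.) Then the following conditions are equivalent: (a) $H_{a,V}$ is strictly positive, i.e. $H_{a,V}\ge\varepsilon I$ for some $\varepsilon>0$. (b) There exist $c\in(0,1)$, $d_1>0$ and $d>0$ such that for every cube $Q_d\subset\mathbb R^n$ $$\mu_{0,\Omega}(Q_d)+d^{-n}M_{c,\Omega}(Q_d;V)\ge \frac1{d_1^2}.$$ (c) There exist $d_1>0$ and $d>0$ such that for every cube $Q_d\subset\mathbb R^n$ $$\mu_{0,\Omega}(Q_d)+d^{-n}M_{c_n,\Omega}(Q_d;V)\ge \frac1{d_1^2}.$$ (d) There exist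 $c\in(0,1)$, $\tilde c>0$ and $d_2>0$ such that for every $d>d_2$ and every cube $Q_d\subset\mathbb R^n$ $$\mu_{0,\Omega}(Q_d)+d^{-n}M_{c,\Omega}(Q_d;V)\ge \frac{\tilde c}{d^2}.$$ (e) There exists $d_2>0$ such that for every $d>d_2$ and every cube $Q_d\subset\mathbb R^n$ $$\mu_{0,\Omega}(Q_d)+d^{-n}M_{c_n,\Omega}(Q_d;V)\ge \frac{\tilde c_n}{d^2}.$$ -/

import Mathlib

open MeasureTheory Filter Topology
open scoped ENNReal ContDiff ComplexConjugate

noncomputable section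

namespace MagneticSchrodinger

/-- The Euclidean space `ℝⁿ`. -/
abbrev E (n : ℕ) : Type := EuclideanSpace ℝ (Fin n)

variable {n : ℕ}

/-- The partial derivative `∂u/∂xʲ` of a complex-valued function. -/
def partialD (u : E n → ℂ) (j : Fin n) (x : E n) : ℂ :=
  fderiv ℝ u x (EuclideanSpace.single j 1)

/-- The `j`-th component `∂u/∂xʲ + i aⱼ u` of the magnetic gradient `∇ₐu`. -/
def magD (a : E n → E n) (u : E n → ℂ) (j : Fin n) (x : E n) : ℂ :=
  partialD u j x + Complex.I * (a x j : ℂ) * u x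

/-- `h_{a,V}(u,u)_G = ∫_G (|∇ₐu|² + V|u|²) dx`, for `V ≥ 0`, with values in `[0,∞]`. -/
def energy (G : Set (E n)) (a : E n → E n) (V : E n → ℝ) (u : E n → ℂ) : ℝ≥0∞ :=
  ∫⁻ x in G, ENNReal.ofReal ((∑ j, ‖magD a u j x‖ ^ 2) + V x * ‖u x‖ ^ 2)

/-- The sesquilinear form `h_{a,V}(u,v) = ∫_G (∇ₐu · conj ∇ₐv + V u conj v) dx`. -/
def sesqForm (G : Set (E n)) (a : E n → E n) (V : E n → ℝ) (u v : E n → ℂ) : ℂ :=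
  ∫ x in G, ((∑ j, magD a u j x * conj (magD a v j x)) + (V x : ℂ) * u x * conj (v x))

/-- `φ ∈ C_c^∞(Ω)` (extended by zero to `ℝⁿ`). -/
structure IsTest (Ω : Set (E n)) (φ : E n → ℂ) : Prop where
  smooth : ContDiff ℝ ∞ φ
  compactSupport : HasCompactSupport φ
  support_subset : tsupport φ ⊆ Ω

/-- The complex Hilbert space `L²(Ω)`. -/
abbrev L2 (Ω : Set (E n)) : Type := Lp ℂ 2 ((volume : Measure (E n)).restrict Ω)

/-- Convergence that defines the closure of the form `h_{a,V}` on `C_c^∞(Ω)`: the test functions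
`φ k` converge to `u` in `L²(Ω)` and are a Cauchy sequence for the form. So `u` is in the domain
of the closed form iff such a sequence exists. -/
structure FormConverges (Ω : Set (E n)) (a : E n → E n) (V : E n → ℝ)
    (φ : ℕ → E n → ℂ) (u : L2 Ω) : Prop where
  test : ∀ k, IsTest Ω (φ k)
  tendsto_L2 : Tendsto (fun k => eLpNorm (fun x => φ k x - u x) 2
    ((volume : Measure (E n)).restrict Ω)) atTop (𝓝 0)
  cauchy : Tendsto (fun p : ℕ × ℕ => energy Ω a V (fun x => φ p.1 x - φ p.2 x)) atTop (𝓝 0)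

/-- The graph of the operator `H_{a,V}` in `L²(Ω)` with Dirichlet boundary conditions, i.e. of the
operator of the closure `h̄` of the form `h_{a,V}` on `C_c^∞(Ω)`: `OperatorGraph Ω a V u f` says
that `u` is in the domain of `H_{a,V}` and `H_{a,V} u = f`, which means that `u` is in the domain
of `h̄` and `h̄(u,ψ) = (f,ψ)` for all `ψ ∈ C_c^∞(Ω)`, where `h̄(u,ψ) = lim h_{a,V}(φ k, ψ)`. -/
def OperatorGraph (Ω : Set (E n)) (a : E n → E n) (V : E n → ℝ) (u f : L2 Ω) : Prop :=
  ∃ φ : ℕ → E n → ℂ, FormConverges Ω a V φ u ∧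
    ∀ ψ : E n → ℂ, IsTest Ω ψ →
      Tendsto (fun k => sesqForm Ω a V (φ k) ψ) atTop (𝓝 (∫ x in Ω, f x * conj (ψ x)))

/-- `H_{a,V} ≥ ε I` in `L²(Ω)` for some `ε > 0`. -/
def StrictlyPositive (Ω : Set (E n)) (a : E n → E n) (V : E n → ℝ) : Prop :=
  ∃ ε : ℝ, 0 < ε ∧ ∀ u f : L2 Ω, OperatorGraph Ω a V u f →
    ε * ‖u‖ ^ 2 ≤ (inner ℂ f u).re

/-- The closed cube `Q_d` with center `x`, edge length `d` and edges parallel to the axes. -/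
def cube (x : E n) (d : ℝ) : Set (E n) := {y | ∀ i, |y i - x i| ≤ d / 2}

/-- The interior of the cube `Q_d` with center `x`. -/
def openCube (x : E n) (d : ℝ) : Set (E n) := {y | ∀ i, |y i - x i| < d / 2}

/-- The Wiener capacity of a compact `F` relative to an open `U`: the infimum of `∫ |∇u|² dx` over
the Lipschitz functions `u` with compact support in `U` that are equal to `1` on `F`
(such a `u` is differentiable almost everywhere). -/
def capacity (U F : Set (E n)) : ℝ≥0∞ :=
  ⨅ u ∈ {u : E n → ℂ | (∃ K, LipschitzWith K u) ∧ HasCompactSupport u ∧ tsupport u ⊆ U ∧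
      ∀ y ∈ F, u y = 1},
    ∫⁻ y, ENNReal.ofReal (∑ j, ‖partialD u j y‖ ^ 2)

/-- The capacity of a compact subset `F` of the cube `Q_d` with center `x`: relative to the
interior of the concentric cube `Q_{2d}` if `n = 2`, and relative to `ℝⁿ` otherwise. -/
def cap (x : E n) (d : ℝ) (F : Set (E n)) : ℝ≥0∞ :=
  if n = 2 then capacity (openCube x (2 * d)) F else capacity Set.univ F

/-- The Molchanov functional `M_{γ,Ω}(Q_d;V)` (`+∞` if no `F` is admissible). -/
def molchanov (Ω : Set (E n)) (γ : ℝ) (x : E n) (d : ℝ) (V : E n → ℝ) : ℝ≥0∞ :=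
  ⨅ F ∈ {F : Set (E n) | IsClosed F ∧ F ⊆ cube x d ∧ cube x d ∩ Ωᶜ ⊆ F ∧
      cap x d F ≤ ENNReal.ofReal γ * cap x d (cube x d)},
    ∫⁻ y in cube x d \ F, ENNReal.ofReal (V y)

/-- `μ_Ω(Q_d;H_{a,V})`: the infimum of the Rayleigh quotients over the functions that are `C^∞` on
the closed cube, not identically zero there, and that vanish in a neighborhood of `Q_d \ Ω`. -/
def neumannBottom (Ω : Set (E n)) (x : E n) (d : ℝ) (a : E n → E n) (V : E n → ℝ) : ℝ≥0∞ :=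
  ⨅ u ∈ {u : E n → ℂ | ContDiff ℝ ∞ u ∧ (∃ y ∈ cube x d, u y ≠ 0) ∧
      ∀ᶠ y in 𝓝ˢ (cube x d ∩ Ωᶜ), u y = 0},
    energy (cube x d) a V u / ∫⁻ y in cube x d, ENNReal.ofReal (‖u y‖ ^ 2)

/-- The local energy of the magnetic field `μ_{0,Ω}(Q_d;a) = μ_Ω(Q_d;H_{a,0})`. -/
def localEnergy (Ω : Set (E n)) (x : E n) (d : ℝ) (a : E n → E n) : ℝ≥0∞ :=
  neumannBottom Ω x d a (fun _ => 0)

/-- The quantity `μ_{0,Ω}(Q_d) + d⁻ⁿ M_{γ,Ω}(Q_d;V)` for the cube `Q_d` with center `x`. -/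
def criterion (Ω : Set (E n)) (a : E n → E n) (V : E n → ℝ) (γ d : ℝ) (x : E n) : ℝ≥0∞ :=
  localEnergy Ω x d a + ENNReal.ofReal ((d ^ n)⁻¹) * molchanov Ω γ x d V

end MagneticSchrodinger

end

open MeasureTheory Filter Topology
open scoped ENNReal ContDiff ComplexConjugate

noncomputable section

namespace MagneticSchrodinger

variable {n : ℕ}

/-! The operator condition is first turned into a form inequality `ε ∫|φ|² ≤ h(φ,φ)` on test
functions (`FormData.strictlyPositive_iff`). The vectors `(φ, √V φ, ∇ₐφ)` in a power of `L²(Ω)` have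
squared norm `‖φ‖² + h(φ,φ)`, so the closure of the form becomes a closed subspace. Projecting
`(f,0,0)` onto that subspace solves `(H+1)u = f`, which supplies enough elements of the operator
graph.

Criterion implies positivity: at a fixed scale `d` one proves `δ ∫_{Q_d}|φ|² ≤ h(φ,φ)_{Q_{2d}}` with
`δ` independent of the cube, and averages over all centres. If the local energy is at least half of
the lower bound, this is its definition. Otherwise the Molchanov functional is bounded below.
Suppose the energy is much smaller than the mass on `Q_{2d}`. By the diamagnetic inequality `|∇|φ||
≤ |∇ₐφ|` and Poincaré, `|φ|` is close in `L²` to a constant `κ > 0`. Then `F = {|φ| ≤ κ/4} ∩ Q_d`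
has small capacity and contains `Q_d \ Ω`, so it is admissible, and `∫_{Q_d \ F} V ≤ (16/κ²) ∫
V|φ|²` is too small: a contradiction (`lintegral_sq_le_energy_of_le_molchanov`).

Positivity implies the criterion at large scales, with constants depending on `n` only: if the
criterion fails on a cube `Q_d`, take an almost minimiser `u` of the local energy, an almost
minimising `F`, a smooth potential `g` for `F`, and a cutoff `χ` that is 1 on `Q_{d/2}`. The
function `χ (1-g) u/√(|u|²+s²)`, with `s²` the mean square of `u`, is bounded by 1, almost vanishes
on `F`, has energy at most `C d^{n-2}`, and mass at least `c d^n` (`exists_test_of_criterion_lt`).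
For large `d` this contradicts positivity. -/

/-! ### Cubes and cutoff functions -/

theorem cube_eq_preimage (x : E n) (d : ℝ) :
    cube x d = (WithLp.ofLp : E n → Fin n → ℝ) ⁻¹'
      Set.pi Set.univ (fun i => Set.Icc (x i - d / 2) (x i + d / 2)) := by
  ext y
  simp only [cube, Set.mem_ofPred_eq, Set.mem_preimage, Set.mem_pi, Set.mem_univ, true_imp_iff,
    Set.mem_Icc, abs_le]
  refine forall_congr' fun i => ⟨fun h => ⟨by linarith [h.1], by linarith [h.2]⟩,
    fun h => ⟨by linarith [h.1], by linarith [h.2]⟩⟩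

theorem isClosed_cube (x : E n) (d : ℝ) : IsClosed (cube x d) := by
  rw [cube_eq_preimage]
  exact (isClosed_set_pi fun i _ => isClosed_Icc).preimage (PiLp.continuous_ofLp 2 _)

theorem isCompact_cube (x : E n) (d : ℝ) : IsCompact (cube x d) := by
  rw [cube_eq_preimage]
  have h : IsCompact (Set.pi Set.univ (fun i => Set.Icc (x i - d / 2) (x i + d / 2))) :=
    isCompact_univ_pi fun i => isCompact_Icc
  exact (PiLp.homeomorph 2 (fun _ : Fin n => ℝ)).isCompact_preimage.2 h

theorem measurableSet_cube (x : E n) (d : ℝ) : MeasurableSet (cube x d) :=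
  (isClosed_cube x d).measurableSet

theorem volume_cube (x : E n) {d : ℝ} (hd : 0 ≤ d) :
    volume (cube x d) = ENNReal.ofReal (d ^ n) := by
  rw [cube_eq_preimage, (PiLp.volume_preserving_ofLp (Fin n)).measure_preimage
    (MeasurableSet.univ_pi fun i => measurableSet_Icc).nullMeasurableSet, volume_pi_pi]
  simp [← ENNReal.ofReal_pow hd]

theorem isOpen_openCube (x : E n) (d : ℝ) : IsOpen (openCube x d) := by
  have : openCube x d = ⋂ i, {y : E n | |y i - x i| < d / 2} := by
    ext y; simp [openCube]
  rw [this]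
  exact isOpen_iInter_of_finite fun i => isOpen_lt (by fun_prop) continuous_const

theorem cube_subset_openCube (x : E n) {d d' : ℝ} (h : d < d') : cube x d ⊆ openCube x d' :=
  fun _ hy i => (hy i).trans_lt (by linarith)

theorem openCube_subset_cube (x : E n) (d : ℝ) : openCube x d ⊆ cube x d :=
  fun _ hy i => (hy i).le

theorem cube_subset_cube (x : E n) {d d' : ℝ} (h : d ≤ d') : cube x d ⊆ cube x d' :=
  fun _ hy i => (hy i).trans (by linarith)

theorem convex_cube (x : E n) (d : ℝ) : Convex ℝ (cube x d) := by
  rw [cube_eq_preimage]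
  exact (convex_pi fun i _ => convex_Icc _ _).linear_preimage
    (WithLp.linearEquiv 2 ℝ (Fin n → ℝ)).toLinearMap

theorem norm_sub_sq_le_of_mem_cube {x y z : E n} {d : ℝ} (hy : y ∈ cube x d) (hz : z ∈ cube x d) :
    ‖y - z‖ ^ 2 ≤ n * d ^ 2 := by
  rw [EuclideanSpace.norm_sq_eq]
  calc ∑ i, ‖(y - z) i‖ ^ 2 ≤ ∑ _i : Fin n, d ^ 2 := by
        refine Finset.sum_le_sum fun i _ => ?_
        have h1 := abs_le.1 (hy i)
        have h2 := abs_le.1 (hz i)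
        have h : |y i - z i| ≤ d := abs_le.2 ⟨by linarith, by linarith⟩
        simpa using pow_le_pow_left₀ (abs_nonneg _) h 2
    _ = n * d ^ 2 := by simp

/-- A smooth cutoff function that is `1` on `Q_d` and is supported in the interior of `Q_{2d}`,
with gradient bounded by `C / d`. -/
theorem exists_cutoff (n : ℕ) : ∃ C : ℝ, 0 < C ∧ ∀ (x : E n) (d : ℝ), 0 < d →
    ∃ χ : E n → ℝ, ContDiff ℝ ∞ χ ∧ HasCompactSupport χ ∧ tsupport χ ⊆ openCube x (2 * d) ∧
      (∀ y, 0 ≤ χ y) ∧ (∀ y, χ y ≤ 1) ∧ (∀ y ∈ cube x d, χ y = 1) ∧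
      ∀ y, ‖fderiv ℝ χ y‖ ≤ C / d := by
  -- A single profile on the unit cube is translated and dilated, so `C` depends on `n` only. The
  -- side 3/2 < 2 keeps the closed support inside the open double cube.
  obtain ⟨f, hf1, hf0, hf⟩ := exists_contMDiffMap_one_nhds_of_subset_interior (n := (⊤ : ℕ∞))
    (modelWithCornersSelf ℝ (E n)) (s := cube (0 : E n) 1) (t := cube (0 : E n) (3 / 2))
    (isClosed_cube _ _) (by
      refine (cube_subset_openCube (0 : E n) (by norm_num : (1 : ℝ) < 3 / 2)).trans ?_
      exact interior_maximal (openCube_subset_cube _ _) (isOpen_openCube _ _))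
  have hfs : ContDiff ℝ ∞ f := f.contMDiff.contDiff
  have hsupp : tsupport f ⊆ cube (0 : E n) (3 / 2) := by
    refine closure_minimal ?_ (isClosed_cube _ _)
    intro y hy
    by_contra h
    exact hy (hf0 y h)
  have hcomp : HasCompactSupport f := (isCompact_cube _ _).of_isClosed_subset (isClosed_tsupport _) hsupp
  have hf1' : ∀ y ∈ cube (0 : E n) 1, f y = 1 := fun y hy => hf1.self_of_nhdsSet y hy
  obtain ⟨C, hC⟩ := (hcomp.fderiv (𝕜 := ℝ)).exists_bound_of_continuous
    (hfs.continuous_fderiv (by simp))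
  refine ⟨max C 1, by positivity, fun x d hd => ?_⟩
  set T : E n → E n := fun y => d⁻¹ • (y - x) with hT
  have hTi : ∀ y i, (T y) i = d⁻¹ * (y i - x i) := fun y i => by simp [hT]
  have hmem : ∀ (r : ℝ) y, T y ∈ cube (0 : E n) r ↔ y ∈ cube x (d * r) := by
    intro r y
    refine forall_congr' fun i => ?_
    rw [hTi]
    simp only [PiLp.zero_apply, sub_zero, abs_mul, abs_inv, abs_of_pos hd]
    rw [inv_mul_le_iff₀ hd, mul_div_assoc]
  have hTd : ∀ y, HasFDerivAt T (d⁻¹ • ContinuousLinearMap.id ℝ (E n)) y := fun y =>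
    ((hasFDerivAt_id y).sub_const x).const_smul d⁻¹
  have hts : tsupport (f ∘ T) ⊆ cube x (d * (3 / 2)) := by
    refine closure_minimal ?_ (isClosed_cube _ _)
    intro y hy
    by_contra h
    exact hy (hf0 _ (fun h' => h ((hmem _ _).1 h')))
  refine ⟨f ∘ T, hfs.comp (by fun_prop), ?_, ?_, ?_, ?_, ?_, ?_⟩
  · exact (isCompact_cube _ _).of_isClosed_subset (isClosed_tsupport _) hts
  · exact hts.trans (cube_subset_openCube _ (by linarith))
  · exact fun y => (hf _).1
  · exact fun y => (hf _).2
  · intro y hy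
    exact hf1' _ ((hmem _ _).2 (by simpa using hy))
  · intro y
    have := ((hfs.differentiable (by simp)).differentiableAt (x := T y)).hasFDerivAt.comp y (hTd y)
    rw [this.fderiv]
    simp only [ContinuousLinearMap.comp_smul, ContinuousLinearMap.comp_id, norm_smul, norm_inv,
      Real.norm_eq_abs, abs_of_pos hd]
    rw [div_eq_inv_mul]
    gcongr
    exact (hC _).trans (le_max_left _ _)

/-! ### Poincaré inequality on convex sets -/

theorem lintegral_mul_sq_le {α : Type*} [MeasurableSpace α] {μ : Measure α} {f g : α → ℝ≥0∞}
    (hf : AEMeasurable f μ) (hg : AEMeasurable g μ) :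
    (∫⁻ x, f x * g x ∂μ) ^ 2 ≤ (∫⁻ x, f x ^ 2 ∂μ) * ∫⁻ x, g x ^ 2 ∂μ := by
  have h := ENNReal.lintegral_mul_le_Lp_mul_Lq μ Real.HolderConjugate.two_two hf hg
  simp only [Pi.mul_apply, ENNReal.rpow_two] at h
  calc (∫⁻ x, f x * g x ∂μ) ^ 2
      ≤ ((∫⁻ x, f x ^ 2 ∂μ) ^ (1 / 2 : ℝ) * (∫⁻ x, g x ^ 2 ∂μ) ^ (1 / 2 : ℝ)) ^ 2 := by gcongr
    _ = _ := by
        rw [mul_pow, ← ENNReal.rpow_natCast, ← ENNReal.rpow_natCast, ← ENNReal.rpow_mul,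
          ← ENNReal.rpow_mul]
        norm_num

theorem sq_lintegral_le {α : Type*} [MeasurableSpace α] {μ : Measure α} {f : α → ℝ≥0∞}
    (hf : AEMeasurable f μ) : (∫⁻ x, f x ∂μ) ^ 2 ≤ μ Set.univ * ∫⁻ x, f x ^ 2 ∂μ := by
  simpa [mul_comm] using lintegral_mul_sq_le hf (aemeasurable_const (b := (1 : ℝ≥0∞)))

theorem enorm_sq_eq_ofReal {F : Type*} [SeminormedAddCommGroup F] (z : F) :
    ‖z‖ₑ ^ 2 = ENNReal.ofReal (‖z‖ ^ 2) := by
  rw [ENNReal.ofReal_pow (norm_nonneg _), ofReal_norm]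

/-- Contracting a convex set towards one of its points by a factor at least `1 / 2`. -/
theorem lintegral_comp_contract_le {Q : Set (E n)} (hQm : MeasurableSet Q) (hQ : Convex ℝ Q)
    {G : E n → ℝ≥0∞} (hG : Measurable G) {y : E n} (hy : y ∈ Q) {s t : ℝ} (ht : 0 ≤ t)
    (hs : 1 / 2 ≤ s) (hst : s + t = 1) :
    ∫⁻ x in Q, G (s • x + t • y) ≤ 2 ^ n * ∫⁻ z in Q, G z := by
  have hs0 : 0 < s := by linarith
  have hmap : Measure.map (fun x : E n => s • x + t • y) volume
      = ENNReal.ofReal |(s ^ n)⁻¹| • volume := by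
    have h1 : (fun x : E n => s • x + t • y) = (fun x => x + t • y) ∘ (fun x => s • x) := rfl
    rw [h1, ← Measure.map_map (by fun_prop) (by fun_prop), Measure.map_addHaar_smul _ hs0.ne',
      Measure.map_smul, map_add_right_eq_self]
    simp
  calc ∫⁻ x in Q, G (s • x + t • y)
      ≤ ∫⁻ x in Q, Q.indicator G (s • x + t • y) := by
        refine setLIntegral_mono' hQm fun x hx => ?_
        rw [Set.indicator_of_mem (hQ hx hy hs0.le ht hst)]
    _ ≤ ∫⁻ x, Q.indicator G (s • x + t • y) := setLIntegral_le_lintegral _ _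
    _ = ∫⁻ z, Q.indicator G z ∂(Measure.map (fun x : E n => s • x + t • y) volume) := by
        rw [lintegral_map (hG.indicator hQm) (by fun_prop)]
    _ = ENNReal.ofReal |(s ^ n)⁻¹| * ∫⁻ z in Q, G z := by
        rw [hmap, lintegral_smul_measure, lintegral_indicator hQm, smul_eq_mul]
    _ ≤ 2 ^ n * ∫⁻ z in Q, G z := by
        gcongr
        rw [abs_of_nonneg (by positivity)]
        refine ENNReal.ofReal_le_of_le_toReal ?_
        simp only [ENNReal.toReal_pow, ENNReal.toReal_ofNat]
        rw [← inv_pow]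
        refine pow_le_pow_left₀ (by positivity) ?_ _
        rw [inv_le_comm₀ hs0 (by norm_num)]
        linarith

theorem sq_sub_le_lintegral_segment {v : E n → ℝ} (hv : ContDiff ℝ 1 v) (x y : E n) :
    ENNReal.ofReal ((v x - v y) ^ 2) ≤ ENNReal.ofReal (‖x - y‖ ^ 2) *
      ∫⁻ t in Set.Icc (0 : ℝ) 1, ENNReal.ofReal (‖fderiv ℝ v ((1 - t) • x + t • y)‖ ^ 2) := by
  have hc : Continuous (fun t : ℝ => fderiv ℝ v ((1 - t) • x + t • y)) :=
    (hv.continuous_fderiv (by simp)).comp (by fun_prop)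
  have hder : ∀ t : ℝ, HasDerivAt (fun t : ℝ => v ((1 - t) • x + t • y))
      (fderiv ℝ v ((1 - t) • x + t • y) (y - x)) t := by
    intro t
    have h1 : HasDerivAt (fun t : ℝ => (1 - t) • x + t • y) (y - x) t := by
      have := (((hasDerivAt_id t).const_sub 1).smul_const x).add ((hasDerivAt_id t).smul_const y)
      have h' : -(1 : ℝ) • x + (1 : ℝ) • y = y - x := by rw [neg_one_smul, one_smul, sub_eq_neg_add]
      rw [h'] at this
      exact this
    exact ((hv.differentiable (by simp)).differentiableAt.hasFDerivAt).comp_hasDerivAt t h1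
  have hint := intervalIntegral.integral_eq_sub_of_hasDerivAt (a := 0) (b := 1)
    (fun t _ => hder t) ((hc.clm_apply continuous_const).intervalIntegrable _ _)
  simp only [sub_self, zero_smul, one_smul, zero_add, sub_zero, add_zero] at hint
  have h2 : ‖v y - v x‖ₑ ≤ ∫⁻ t in Set.Icc (0 : ℝ) 1,
      ‖fderiv ℝ v ((1 - t) • x + t • y)‖ₑ * ‖x - y‖ₑ := by
    rw [← hint, intervalIntegral.integral_of_le zero_le_one, ← integral_Icc_eq_integral_Ioc]
    refine (enorm_integral_le_lintegral_enorm _).trans (lintegral_mono fun t => ?_)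
    rw [← enorm_neg (x - y), neg_sub]
    exact ContinuousLinearMap.le_opENorm _ _
  rw [lintegral_mul_const' _ _ enorm_ne_top] at h2
  have h3 := sq_lintegral_le (μ := volume.restrict (Set.Icc (0 : ℝ) 1))
    (f := fun t => ‖fderiv ℝ v ((1 - t) • x + t • y)‖ₑ) hc.enorm.measurable.aemeasurable
  simp only [MeasurableSet.univ, Measure.restrict_apply, Set.univ_inter, Real.volume_Icc, sub_zero,
    ENNReal.ofReal_one, one_mul] at h3
  calc ENNReal.ofReal ((v x - v y) ^ 2) = ‖v y - v x‖ₑ ^ 2 := by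
        rw [enorm_sq_eq_ofReal, Real.norm_eq_abs, sq_abs, ← neg_sub, neg_sq]
    _ ≤ _ := pow_le_pow_left' h2 2
    _ = ‖x - y‖ₑ ^ 2 * (∫⁻ t in Set.Icc (0 : ℝ) 1, ‖fderiv ℝ v ((1 - t) • x + t • y)‖ₑ) ^ 2 := by
        rw [mul_pow, mul_comm]
    _ ≤ _ := by
        rw [enorm_sq_eq_ofReal]
        gcongr
        refine h3.trans_eq (lintegral_congr fun t => ?_)
        exact enorm_sq_eq_ofReal _

/-- Poincaré inequality in double integral form, on a convex set. -/
theorem lintegral_prod_sq_sub_le {Q : Set (E n)} (hQm : MeasurableSet Q) (hQ : Convex ℝ Q)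
    (hQv : volume Q ≠ ⊤) {L : ℝ} (hL : ∀ x ∈ Q, ∀ y ∈ Q, ‖x - y‖ ^ 2 ≤ L)
    {v : E n → ℝ} (hv : ContDiff ℝ 1 v) :
    ∫⁻ p, ENNReal.ofReal ((v p.1 - v p.2) ^ 2)
        ∂((volume.restrict Q).prod (volume.restrict Q)) ≤
      ENNReal.ofReal L * (volume Q * (2 ^ n * ∫⁻ z in Q, ENNReal.ofReal (‖fderiv ℝ v z‖ ^ 2))) := by
  set G : E n → ℝ≥0∞ := fun z => ENNReal.ofReal (‖fderiv ℝ v z‖ ^ 2) with hGdef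
  have hGc : Continuous G := by
    have := hv.continuous_fderiv (by simp)
    exact ENNReal.continuous_ofReal.comp (by fun_prop)
  have hG : Measurable G := hGc.measurable
  set ν := (volume.restrict Q).prod (volume.restrict Q) with hν
  have : IsFiniteMeasure (volume.restrict Q) := ⟨by simpa using hQv.lt_top⟩
  have hmem : ∀ᵐ p ∂ν, p.1 ∈ Q ∧ p.2 ∈ Q := by
    rw [hν, Measure.prod_restrict]
    exact ae_restrict_of_forall_mem (hQm.prod hQm) fun p hp => hp
  calc ∫⁻ p, ENNReal.ofReal ((v p.1 - v p.2) ^ 2) ∂ν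
      ≤ ∫⁻ p, (ENNReal.ofReal L * ∫⁻ t in Set.Icc (0 : ℝ) 1, G ((1 - t) • p.1 + t • p.2)) ∂ν := by
        refine lintegral_mono_ae ?_
        filter_upwards [hmem] with p hp
        refine (sq_sub_le_lintegral_segment hv p.1 p.2).trans ?_
        gcongr
        exact hL _ hp.1 _ hp.2
    _ = ENNReal.ofReal L * ∫⁻ t in Set.Icc (0 : ℝ) 1, ∫⁻ p, G ((1 - t) • p.1 + t • p.2) ∂ν := by
        rw [lintegral_const_mul' _ _ ENNReal.ofReal_ne_top, lintegral_lintegral_swap]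
        refine Continuous.aemeasurable ?_
        exact hGc.comp (by fun_prop)
    _ ≤ ENNReal.ofReal L * ∫⁻ _t in Set.Icc (0 : ℝ) 1, volume Q * (2 ^ n * ∫⁻ z in Q, G z) := by
        refine mul_le_mul_right ?_ _
        refine setLIntegral_mono' measurableSet_Icc fun t ht => ?_
        have hm : AEMeasurable (fun p : E n × E n => G ((1 - t) • p.1 + t • p.2)) ν :=
          (hGc.comp (by fun_prop)).aemeasurable
        -- Change variables in whichever of the two points carries weight at least 1/2; the Jacobian
        -- then costs at most `2 ^ n`.
        rcases le_total t (1 / 2) with h | h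
        · rw [hν, lintegral_prod_symm _ hm]
          calc _ ≤ ∫⁻ _y in Q, 2 ^ n * ∫⁻ z in Q, G z := by
                refine setLIntegral_mono' hQm fun y hy => ?_
                exact lintegral_comp_contract_le hQm hQ hG hy ht.1 (by linarith) (by ring)
            _ = _ := by simp [mul_comm]
        · rw [hν, lintegral_prod _ hm]
          calc _ ≤ ∫⁻ _y in Q, 2 ^ n * ∫⁻ z in Q, G z := by
                refine setLIntegral_mono' hQm fun y hy => ?_
                simp_rw [add_comm ((1 - t) • y)]
                exact lintegral_comp_contract_le hQm hQ hG hy (by linarith [ht.2]) (by linarith)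
                  (by ring)
            _ = _ := by simp [mul_comm]
    _ = _ := by simp

/-! ### Diamagnetic inequality -/

/-- The vector `i aⱼ u` is orthogonal to `u` over the reals. This is the source of every diamagnetic
estimate below: derivatives of functions of `|u|²` do not see the magnetic potential. -/
theorem inner_magD (a : E n → E n) (u : E n → ℂ) (j : Fin n) (x : E n) :
    inner ℝ (u x) (magD a u j x) = inner ℝ (u x) (partialD u j x) := by
  simp only [magD, Complex.inner, inner_add_right]
  simp
  ring

theorem norm_fderiv_sq_le_sum {F : Type*} [NormedAddCommGroup F] [NormedSpace ℝ F]
    (l : E n →L[ℝ] F) :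
    ‖l‖ ^ 2 ≤ ∑ j, ‖l (EuclideanSpace.single j 1)‖ ^ 2 := by
  have h : ‖l‖ ≤ Real.sqrt (∑ j, ‖l (EuclideanSpace.single j 1)‖ ^ 2) := by
    refine l.opNorm_le_bound (Real.sqrt_nonneg _) fun w => ?_
    have hw : w = ∑ j, w j • EuclideanSpace.single j (1 : ℝ) := by
      ext i; simp [Pi.single_apply]
    calc ‖l w‖ = ‖∑ j, w j • l (EuclideanSpace.single j 1)‖ := by
          conv_lhs => rw [hw]
          simp
      _ ≤ ∑ j, ‖l (EuclideanSpace.single j 1)‖ * ‖w j‖ := by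
          refine (norm_sum_le _ _).trans (Finset.sum_le_sum fun j _ => ?_)
          rw [norm_smul, mul_comm]
      _ ≤ Real.sqrt (∑ j, ‖l (EuclideanSpace.single j 1)‖ ^ 2) * Real.sqrt (∑ j, ‖w j‖ ^ 2) :=
          Real.sum_mul_le_sqrt_mul_sqrt _ _ _
      _ = _ := by rw [EuclideanSpace.norm_eq]
  calc ‖l‖ ^ 2 ≤ _ := pow_le_pow_left₀ (norm_nonneg _) h 2
    _ = _ := Real.sq_sqrt (by positivity)

/-- The regularised modulus `√(|u|² + ε²)`. -/
def regNorm (u : E n → ℂ) (ε : ℝ) (x : E n) : ℝ := Real.sqrt (‖u x‖ ^ 2 + ε ^ 2)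

theorem contDiff_regNorm {u : E n → ℂ} {k : ℕ∞ω} (hu : ContDiff ℝ k u) {ε : ℝ} (hε : 0 < ε) :
    ContDiff ℝ k (regNorm u ε) :=
  ((hu.norm_sq ℝ).add contDiff_const).sqrt fun x => by positivity

/-- Kato's inequality for the regularised modulus, componentwise. -/
theorem norm_fderiv_regNorm_apply_le (a : E n → E n) {u : E n → ℂ} (hu : ContDiff ℝ 1 u) {ε : ℝ}
    (hε : 0 < ε) (x : E n) (j : Fin n) :
    ‖fderiv ℝ (regNorm u ε) x (EuclideanSpace.single j 1)‖ ≤ ‖magD a u j x‖ := by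
  have hpos : 0 < ‖u x‖ ^ 2 + ε ^ 2 := by positivity
  have h1 := (((hu.differentiable (by simp)).differentiableAt (x := x)).hasFDerivAt.norm_sq.add_const
    (ε ^ 2)).sqrt hpos.ne'
  have h2 : fderiv ℝ (regNorm u ε) x (EuclideanSpace.single j 1)
      = inner ℝ (u x) (magD a u j x) / Real.sqrt (‖u x‖ ^ 2 + ε ^ 2) := by
    rw [show regNorm u ε = fun y => Real.sqrt (‖u y‖ ^ 2 + ε ^ 2) from rfl, h1.fderiv, inner_magD]
    simp [partialD]
    field_simp
  have hs : 0 < Real.sqrt (‖u x‖ ^ 2 + ε ^ 2) := Real.sqrt_pos.2 hpos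
  rw [h2, norm_div, Real.norm_of_nonneg hs.le, div_le_iff₀ hs]
  refine (norm_inner_le_norm _ _).trans ?_
  rw [mul_comm]
  gcongr
  exact Real.le_sqrt_of_sq_le (by nlinarith)

/-- Kato's inequality for the regularised modulus. -/
theorem norm_fderiv_regNorm_sq_le (a : E n → E n) {u : E n → ℂ} (hu : ContDiff ℝ 1 u) {ε : ℝ}
    (hε : 0 < ε) (x : E n) : ‖fderiv ℝ (regNorm u ε) x‖ ^ 2 ≤ ∑ j, ‖magD a u j x‖ ^ 2 := by
  refine (norm_fderiv_sq_le_sum _).trans (Finset.sum_le_sum fun j _ => ?_)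
  gcongr
  exact norm_fderiv_regNorm_apply_le a hu hε x j

theorem tendsto_regNorm (u : E n → ℂ) (x : E n) :
    Tendsto (fun k : ℕ => regNorm u (1 / ((k : ℝ) + 1)) x) atTop (𝓝 ‖u x‖) := by
  have h := tendsto_one_div_add_atTop_nhds_zero_nat (𝕜 := ℝ)
  have : Tendsto (fun k : ℕ => ‖u x‖ ^ 2 + (1 / ((k : ℝ) + 1)) ^ 2) atTop (𝓝 (‖u x‖ ^ 2 + 0 ^ 2)) :=
    tendsto_const_nhds.add (h.pow 2)
  have h2 := (Real.continuous_sqrt.tendsto _).comp this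
  simpa [regNorm, Function.comp_def, Real.sqrt_sq] using h2

/-- Diamagnetic Poincaré inequality on a cube. -/
theorem exists_sq_norm_sub_le_energy (a : E n → E n) {u : E n → ℂ} (hu : ContDiff ℝ 1 u)
    (x : E n) {d : ℝ} (hd : 0 < d) :
    ∃ κ : ℝ, 0 ≤ κ ∧ ∫⁻ y in cube x d, ENNReal.ofReal ((‖u y‖ - κ) ^ 2) ≤
      ENNReal.ofReal (n * 2 ^ n * d ^ 2) * energy (cube x d) a (fun _ => 0) u := by
  set Q := cube x d with hQ
  have hQm : MeasurableSet Q := measurableSet_cube x d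
  have hvol : volume Q = ENNReal.ofReal (d ^ n) := volume_cube x hd.le
  have hv0 : volume Q ≠ 0 := by rw [hvol]; simpa using pow_pos hd n
  have hvt : volume Q ≠ ⊤ := by rw [hvol]; exact ENNReal.ofReal_ne_top
  have : IsFiniteMeasure (volume.restrict Q) := ⟨by simpa using hvt.lt_top⟩
  set ν := (volume.restrict Q).prod (volume.restrict Q) with hν
  set B := ENNReal.ofReal (n * d ^ 2) * (volume Q * (2 ^ n * energy Q a (fun _ => 0) u)) with hB
  have hk : ∀ ε : ℝ, 0 < ε →
      ∫⁻ p, ENNReal.ofReal ((regNorm u ε p.1 - regNorm u ε p.2) ^ 2) ∂ν ≤ B := by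
    intro ε hε
    refine (lintegral_prod_sq_sub_le hQm (convex_cube x d) hvt
      (fun y hy z hz => norm_sub_sq_le_of_mem_cube hy hz) (contDiff_regNorm hu hε)).trans ?_
    rw [hB]
    gcongr
    refine lintegral_mono fun z => ENNReal.ofReal_le_ofReal ?_
    simpa using norm_fderiv_regNorm_sq_le a hu hε z
  have huc : Continuous fun y => ‖u y‖ := hu.continuous.norm
  -- `|u|` need not be differentiable at zeros of `u`; the bound for the regularised modulus is
  -- uniform in `ε`, and Fatou's lemma carries it to the limit.
  have hlim : ∫⁻ p, ENNReal.ofReal ((‖u p.1‖ - ‖u p.2‖) ^ 2) ∂ν ≤ B := by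
    calc ∫⁻ p, ENNReal.ofReal ((‖u p.1‖ - ‖u p.2‖) ^ 2) ∂ν
        = ∫⁻ p, liminf (fun k : ℕ => ENNReal.ofReal ((regNorm u (1 / ((k : ℝ) + 1)) p.1
            - regNorm u (1 / ((k : ℝ) + 1)) p.2) ^ 2)) atTop ∂ν := by
          refine lintegral_congr fun p => (Tendsto.liminf_eq ?_).symm
          exact ENNReal.tendsto_ofReal (((tendsto_regNorm u p.1).sub (tendsto_regNorm u p.2)).pow 2)
      _ ≤ liminf (fun k : ℕ => ∫⁻ p, ENNReal.ofReal ((regNorm u (1 / ((k : ℝ) + 1)) p.1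
            - regNorm u (1 / ((k : ℝ) + 1)) p.2) ^ 2) ∂ν) atTop := by
          refine lintegral_liminf_le fun k => ?_
          have hc := (contDiff_regNorm hu (ε := 1 / ((k : ℝ) + 1)) (by positivity)).continuous
          exact (ENNReal.continuous_ofReal.comp (by fun_prop)).measurable
      _ ≤ B := by
          refine liminf_le_of_le (by isBoundedDefault) fun b hb => ?_
          obtain ⟨k, hk'⟩ := hb.exists
          exact hk'.trans (hk _ (by positivity))
  have hcont : Continuous fun p : E n × E n => ENNReal.ofReal ((‖u p.1‖ - ‖u p.2‖) ^ 2) :=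
    ENNReal.continuous_ofReal.comp (by fun_prop)
  rw [lintegral_prod_symm _ hcont.aemeasurable] at hlim
  -- Some point `y` does no worse than the average of the double integral, so `κ = |u(y)|` serves in
  -- place of the mean of `|u|`.
  obtain ⟨y, hy, hy'⟩ := exists_le_setLAverage hv0 hvt
    (f := fun y => ∫⁻ x in Q, ENNReal.ofReal ((‖u x‖ - ‖u y‖) ^ 2))
    (Measurable.lintegral_prod_left' hcont.measurable).aemeasurable
  refine ⟨‖u y‖, norm_nonneg _, hy'.trans ?_⟩
  rw [setLAverage_eq]
  refine (ENNReal.div_le_div_right hlim _).trans ?_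
  rw [hB, mul_left_comm, mul_comm (volume Q), ENNReal.mul_div_cancel_right hv0 hvt]
  have h2 : ENNReal.ofReal (n * 2 ^ n * d ^ 2) = ENNReal.ofReal (n * d ^ 2) * 2 ^ n := by
    rw [mul_right_comm, ENNReal.ofReal_mul (by positivity), ENNReal.ofReal_pow (by norm_num)]
    simp
  rw [h2, mul_assoc]

/-! ### Mollification of Lipschitz functions -/

theorem norm_fderiv_apply_le_of_dist_le {F G : Type*} [NormedAddCommGroup F] [NormedSpace ℝ F]
    [NormedAddCommGroup G] [NormedSpace ℝ G] {f : E n → F} {P : E n → G} {y : E n}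
    (hf : DifferentiableAt ℝ f y) (hP : DifferentiableAt ℝ P y)
    (h : ∀ x z, ‖f x - f z‖ ≤ ‖P x - P z‖) (w : E n) :
    ‖fderiv ℝ f y w‖ ≤ ‖fderiv ℝ P y w‖ := by
  have hf' := (hf.hasFDerivAt.hasLineDerivAt w).tendsto_slope_zero
  have hP' := (hP.hasFDerivAt.hasLineDerivAt w).tendsto_slope_zero
  refine le_of_tendsto_of_tendsto' hf'.norm hP'.norm fun t => ?_
  rw [norm_smul, norm_smul]
  gcongr
  exact h _ _

/-- By Rademacher's theorem `f` is differentiable almost everywhere, and its Lipschitz constant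
dominates the difference quotients. Keeping the derivative on `f` instead of `ρ` makes the gradient
of the mollification an average of gradients. -/
theorem convolution_hasFDerivAt {ρ f : E n → ℝ} (hρ : Continuous ρ) (hρc : HasCompactSupport ρ)
    {K : NNReal} (hf : LipschitzWith K f) (x : E n) :
    HasFDerivAt (fun x => ∫ t, ρ t • f (x - t)) (∫ t, ρ t • fderiv ℝ f (x - t)) x := by
  have hcont : ∀ x : E n, Continuous (fun t => ρ t • f (x - t)) := fun x => by
    have := hf.continuous
    fun_prop
  refine (hasFDerivAt_integral_of_dominated_loc_of_lip (s := Set.univ)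
    (bound := fun t => K * ‖ρ t‖) Filter.univ_mem ?_ ?_ ?_ ?_ ?_ ?_).2
  · exact Eventually.of_forall fun x => (hcont x).aestronglyMeasurable
  · exact (hcont x).integrable_of_hasCompactSupport hρc.smul_right
  · refine (hρ.aestronglyMeasurable).smul ?_
    exact ((measurable_fderiv ℝ f).comp (measurable_const.sub measurable_id)).aestronglyMeasurable
  · refine Eventually.of_forall fun t => LipschitzWith.lipschitzOnWith ?_
    refine LipschitzWith.of_dist_le_mul fun y z => ?_
    rw [dist_smul₀, Real.coe_nnabs, abs_of_nonneg (by positivity), mul_comm (K : ℝ), mul_assoc]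
    gcongr
    simpa using hf.dist_le_mul (y - t) (z - t)
  · exact ((hρ.norm.integrable_of_hasCompactSupport hρc.norm)).const_mul _
  · have h := hf.ae_differentiableAt (μ := (volume : Measure (E n)))
    have h2 : ∀ᵐ t : E n, DifferentiableAt ℝ f (x - t) :=
      (Measure.measurePreserving_sub_left volume x).quasiMeasurePreserving.ae h
    filter_upwards [h2] with t ht
    have := (ht.hasFDerivAt.comp x ((hasFDerivAt_id x).sub_const t)).const_smul (ρ t)
    rw [ContinuousLinearMap.comp_id] at this
    exact this

/-- Cauchy–Schwarz for the probability measure `ρ dt`, then Tonelli and translation invariance.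
Applied to the partial derivatives, it shows that mollifying does not raise the Dirichlet integral.
-/
theorem lintegral_sq_norm_convolution_le {ρ : E n → ℝ} (hρ : Continuous ρ)
    (hρ1 : ∫⁻ t, ENNReal.ofReal (ρ t) = 1) (hρ0 : ∀ t, 0 ≤ ρ t) {h : E n → ℝ} (hh : Measurable h) :
    ∫⁻ x, ‖∫ t, ρ t • h (x - t)‖ₑ ^ 2 ≤ ∫⁻ x, ‖h x‖ₑ ^ 2 := by
  have hm : Measurable fun t => ENNReal.ofReal (ρ t) := hρ.measurable.ennreal_ofReal
  set ν : Measure (E n) := volume.withDensity (fun t => ENNReal.ofReal (ρ t)) with hν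
  have hν1 : ν Set.univ = 1 := by
    rw [hν, withDensity_apply _ MeasurableSet.univ, Measure.restrict_univ, hρ1]
  have : IsProbabilityMeasure ν := ⟨hν1⟩
  calc ∫⁻ x, ‖∫ t, ρ t • h (x - t)‖ₑ ^ 2
      ≤ ∫⁻ x, ∫⁻ t, ‖h (x - t)‖ₑ ^ 2 ∂ν := by
        refine lintegral_mono fun x => ?_
        have hx : Measurable fun t => ‖h (x - t)‖ₑ :=
          (hh.comp (measurable_const.sub measurable_id)).enorm
        have h1 : ‖∫ t, ρ t • h (x - t)‖ₑ ≤ ∫⁻ t, ‖h (x - t)‖ₑ ∂ν := by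
          rw [hν, lintegral_withDensity_eq_lintegral_mul _ hm hx]
          refine (enorm_integral_le_lintegral_enorm _).trans_eq (lintegral_congr fun t => ?_)
          rw [enorm_smul, Real.enorm_of_nonneg (hρ0 t), Pi.mul_apply]
        refine (pow_le_pow_left' h1 2).trans ?_
        simpa [hν1] using sq_lintegral_le (μ := ν) hx.aemeasurable
    _ = ∫⁻ t, (∫⁻ x, ‖h (x - t)‖ₑ ^ 2) ∂ν := by
        refine lintegral_lintegral_swap (Measurable.aemeasurable ?_)
        exact ((hh.comp (measurable_fst.sub measurable_snd)).enorm).pow_const 2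
    _ = ∫⁻ _t, (∫⁻ x, ‖h x‖ₑ ^ 2) ∂ν := by
        refine lintegral_congr fun t => ?_
        exact lintegral_sub_right_eq_self (fun x => ‖h x‖ₑ ^ 2) t
    _ = _ := by simp

/-- The Dirichlet integral of a real function. -/
def dirichlet (g : E n → ℝ) : ℝ≥0∞ :=
  ∫⁻ y, ENNReal.ofReal (∑ j, ‖fderiv ℝ g y (EuclideanSpace.single j 1)‖ ^ 2)

theorem dirichlet_eq_sum (g : E n → ℝ) :
    dirichlet g = ∑ j, ∫⁻ y, ‖fderiv ℝ g y (EuclideanSpace.single j 1)‖ₑ ^ 2 := by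
  rw [← lintegral_finsetSum _ fun j _ => (measurable_fderiv_apply_const ℝ g _).enorm.pow_const 2]
  refine lintegral_congr fun y => ?_
  rw [ENNReal.ofReal_sum_of_nonneg fun j _ => by positivity]
  simp_rw [enorm_sq_eq_ofReal]

theorem lintegral_sq_norm_fderiv_le_dirichlet (g : E n → ℝ) :
    ∫⁻ y, ENNReal.ofReal (‖fderiv ℝ g y‖ ^ 2) ≤ dirichlet g :=
  lintegral_mono fun _ => ENNReal.ofReal_le_ofReal (norm_fderiv_sq_le_sum _)

/-- Mollification of a Lipschitz function with values in `[0, 1]`. -/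
theorem exists_smooth_approx_dirichlet_le {f : E n → ℝ} {K : NNReal} (hf : LipschitzWith K f)
    (hfc : HasCompactSupport f) (hf0 : ∀ y, 0 ≤ f y) (hf1 : ∀ y, f y ≤ 1) {U : Set (E n)}
    (hU : IsOpen U) (hfU : tsupport f ⊆ U) {δ : ℝ} (hδ : 0 < δ) :
    ∃ g : E n → ℝ, ContDiff ℝ ∞ g ∧ HasCompactSupport g ∧ tsupport g ⊆ U ∧
      (∀ y, 0 ≤ g y) ∧ (∀ y, g y ≤ 1) ∧ (∀ y, |g y - f y| ≤ δ) ∧ dirichlet g ≤ dirichlet f := by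
  obtain ⟨r, hr, hrU⟩ := IsCompact.exists_cthickening_subset_open hfc hU hfU
  -- The radius `r` keeps the support in `U`; radius `δ / (K + 1)` moves a `K`-Lipschitz function by
  -- at most `δ`, with `+ 1` covering `K = 0`.
  set s := min r (δ / (K + 1)) with hs
  have hs0 : 0 < s := lt_min hr (by positivity)
  let φ : ContDiffBump (0 : E n) := ⟨s / 2, s, by positivity, by linarith⟩
  set ρ := φ.normed volume with hρ
  have hρc : Continuous ρ := φ.continuous_normed
  have hρ0 : ∀ t, 0 ≤ ρ t := φ.nonneg_normed
  have hρs : HasCompactSupport ρ := φ.hasCompactSupport_normed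
  have hρ1 : ∫⁻ t, ENNReal.ofReal (ρ t) = 1 := by
    rw [← ofReal_integral_eq_lintegral_ofReal φ.integrable_normed (Eventually.of_forall hρ0),
      φ.integral_normed, ENNReal.ofReal_one]
  set g : E n → ℝ := fun x => ∫ t, ρ t • f (x - t) with hg
  have hgconv : g = convolution ρ f (ContinuousLinearMap.lsmul ℝ ℝ) volume := rfl
  have hint : ∀ x, Integrable (fun t => ρ t • f (x - t)) := fun x =>
    (hρc.smul (hf.continuous.comp (by fun_prop))).integrable_of_hasCompactSupport hρs.smul_right
  have hsupp : tsupport g ⊆ Metric.cthickening r (tsupport f) := by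
    refine closure_minimal ?_ Metric.isClosed_cthickening
    rw [hgconv]
    refine (support_convolution_subset _).trans ?_
    rintro _ ⟨y, hy, z, hz, rfl⟩
    rw [φ.support_normed_eq] at hy
    refine Metric.mem_cthickening_of_dist_le (y + z) z r _ (subset_tsupport _ hz) ?_
    have : ‖y‖ < s := by simpa using hy
    simpa using this.le.trans (min_le_left _ _)
  refine ⟨g, ?_, ?_, hsupp.trans hrU, ?_, ?_, ?_, ?_⟩
  · rw [hgconv]
    exact hρs.contDiff_convolution_left _ φ.contDiff_normed hf.continuous.locallyIntegrable
  · exact (hfc.isCompact.cthickening).of_isClosed_subset (isClosed_tsupport _) hsupp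
  · exact fun y => integral_nonneg fun t => mul_nonneg (hρ0 t) (hf0 _)
  · intro y
    calc g y ≤ ∫ t, ρ t := by
          refine integral_mono (hint y) φ.integrable_normed fun t => ?_
          exact mul_le_of_le_one_right (hρ0 t) (hf1 _)
      _ = 1 := φ.integral_normed
  · intro y
    have := φ.dist_normed_convolution_le (μ := volume) (g := f) (x₀ := y) (ε := δ)
      hf.continuous.aestronglyMeasurable (by
        intro z hz
        refine (hf.dist_le_mul z y).trans ?_
        have hz' : dist z y ≤ δ / (K + 1) := (Metric.mem_ball.1 hz).le.trans (min_le_right _ _)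
        calc (K : ℝ) * dist z y ≤ K * (δ / (K + 1)) := by gcongr
          _ ≤ (K + 1) * (δ / (K + 1)) := by gcongr; linarith
          _ = δ := by field_simp)
    exact this
  · rw [dirichlet_eq_sum, dirichlet_eq_sum]
    refine Finset.sum_le_sum fun j _ => ?_
    refine le_trans (le_of_eq (lintegral_congr fun x => ?_))
      (lintegral_sq_norm_convolution_le hρc hρ1 hρ0
        (measurable_fderiv_apply_const ℝ f (EuclideanSpace.single j 1)))
    have hd := convolution_hasFDerivAt hρc hρs hf x
    rw [hd.fderiv]
    congr 2
    rw [ContinuousLinearMap.integral_apply]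
    · rfl
    · have hm : AEStronglyMeasurable (fun t => ρ t • fderiv ℝ f (x - t)) volume :=
        hρc.aestronglyMeasurable.smul
          ((measurable_fderiv ℝ f).comp (measurable_const.sub measurable_id)).aestronglyMeasurable
      refine (φ.integrable_normed.const_mul (K : ℝ)).mono' hm (Eventually.of_forall fun t => ?_)
      rw [norm_smul, Real.norm_of_nonneg (hρ0 t), mul_comm]
      exact mul_le_mul_of_nonneg_right (norm_fderiv_le_of_lipschitz ℝ hf) (hρ0 t)

/-! ### Mass on a cube against the Dirichlet integral -/

theorem eLpNorm_two_sq_eq {F : Type*} [NormedAddCommGroup F] (f : E n → F) (μ : Measure (E n)) :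
    eLpNorm f 2 μ ^ 2 = ∫⁻ y, ENNReal.ofReal (‖f y‖ ^ 2) ∂μ := by
  have := eLpNorm_nnreal_pow_eq_lintegral (f := f) (μ := μ) (p := 2) (by norm_num)
  simp only [NNReal.coe_ofNat, ENNReal.rpow_two, ENNReal.coe_ofNat] at this
  rw [this]
  exact lintegral_congr fun y => enorm_sq_eq_ofReal _

/-- Sobolev's inequality on the whole space followed by Hölder on the cube. No restriction on the
support of `g` relative to the cube is needed, which matches capacity relative to `ℝⁿ`. -/
theorem lintegral_sq_cube_le_of_three_le (hn : 3 ≤ n) : ∃ C : ℝ, 0 < C ∧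
    ∀ (x : E n) (d : ℝ), 0 < d → ∀ g : E n → ℝ, ContDiff ℝ 1 g → HasCompactSupport g →
      ∫⁻ y in cube x d, ENNReal.ofReal (‖g y‖ ^ 2) ≤ ENNReal.ofReal (C * d ^ 2) * dirichlet g := by
  have hn0 : (3 : ℝ) ≤ n := by exact_mod_cast hn
  have hfin : Module.finrank ℝ (E n) = n := finrank_euclideanSpace_fin
  obtain ⟨c, hc⟩ : ∃ c : NNReal,
      c = eLpNormLESNormFDerivOfEqInnerConst (volume : Measure (E n)) (2 : NNReal) := ⟨_, rfl⟩
  have hpos : (0 : ℝ) < 2⁻¹ - (n : ℝ)⁻¹ := by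
    rw [sub_pos]
    exact inv_strictAnti₀ (by norm_num) (by linarith)
  -- The Sobolev exponent `2n/(n-2)`, finite because `n ≥ 3`. Since `1/2 - 1/p' = 1/n`, Hölder on
  -- the cube costs exactly one factor `d`.
  obtain ⟨p', hp'c⟩ : ∃ p' : NNReal, (p' : ℝ) = (2⁻¹ - (n : ℝ)⁻¹)⁻¹ :=
    ⟨⟨(2⁻¹ - (n : ℝ)⁻¹)⁻¹, by positivity⟩, rfl⟩
  refine ⟨c ^ 2 + 1, by positivity, fun x d hd g hg hgc => ?_⟩
  have h1 : eLpNorm g p' volume ≤ c * eLpNorm (fderiv ℝ g) (2 : NNReal) volume := by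
    rw [hc]
    exact eLpNorm_le_eLpNorm_fderiv_of_eq_inner volume hg hgc (by norm_num) (by rw [hfin]; omega)
      (by rw [hfin, hp'c, inv_inv]; norm_num)
  have h2p : (2 : ℝ≥0∞) ≤ p' := by
    have : (2 : NNReal) ≤ p' := by
      rw [← NNReal.coe_le_coe, hp'c, NNReal.coe_ofNat, le_inv_comm₀ (by norm_num) hpos]
      have : (0 : ℝ) ≤ (n : ℝ)⁻¹ := by positivity
      linarith
    exact_mod_cast this
  have h2 := eLpNorm_le_eLpNorm_mul_rpow_measure_univ (μ := volume.restrict (cube x d)) h2p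
    hg.continuous.aestronglyMeasurable
  have hexp : (1 / (2 : ℝ≥0∞).toReal - 1 / (p' : ℝ≥0∞).toReal) = (n : ℝ)⁻¹ := by
    simp [hp'c]
  have hvol : (volume.restrict (cube x d)) Set.univ ^ (n : ℝ)⁻¹ = ENNReal.ofReal d := by
    rw [Measure.restrict_apply_univ, volume_cube x hd.le,
      ENNReal.ofReal_rpow_of_pos (by positivity), ← Real.rpow_natCast, ← Real.rpow_mul hd.le,
      mul_inv_cancel₀ (by positivity), Real.rpow_one]
  rw [hexp, hvol] at h2
  have h3 : eLpNorm g 2 (volume.restrict (cube x d)) ≤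
      c * eLpNorm (fderiv ℝ g) 2 volume * ENNReal.ofReal d := by
    refine h2.trans ?_
    gcongr
    exact (eLpNorm_mono_measure _ Measure.restrict_le_self).trans h1
  rw [← eLpNorm_two_sq_eq]
  calc _ ≤ (c * eLpNorm (fderiv ℝ g) 2 volume * ENNReal.ofReal d) ^ 2 := by gcongr
    _ = (c : ℝ≥0∞) ^ 2 * ENNReal.ofReal (d ^ 2) * (eLpNorm (fderiv ℝ g) 2 volume) ^ 2 := by
        rw [mul_pow, mul_pow, ENNReal.ofReal_pow hd.le]; ring
    _ ≤ _ := by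
        rw [eLpNorm_two_sq_eq, ENNReal.ofReal_mul (by positivity)]
        gcongr
        · rw [← ENNReal.ofReal_coe_nnreal, ← ENNReal.ofReal_pow (by positivity)]
          exact ENNReal.ofReal_le_ofReal (by linarith)
        · exact lintegral_sq_norm_fderiv_le_dirichlet g

/-- Each point of `Q_d` is joined to a point outside the support by the same translation vector;
integrating the gradient along these segments gives the bound. This replaces Sobolev's inequality
when `n = 2`. -/
theorem lintegral_sq_cube_le_of_tsupport_subset (hn : 1 ≤ n) (x : E n) {d : ℝ} (hd : 0 < d)
    {g : E n → ℝ} (hg : ContDiff ℝ 1 g) (hgs : tsupport g ⊆ openCube x (2 * d)) :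
    ∫⁻ y in cube x d, ENNReal.ofReal (‖g y‖ ^ 2) ≤ ENNReal.ofReal (4 * d ^ 2) * dirichlet g := by
  -- A shift by `2d` takes a first coordinate within `d/2` of the centre to distance at least
  -- `3d/2`, beyond the half-side `d` of `Q_{2d}`.
  set e : E n := EuclideanSpace.single ⟨0, hn⟩ (2 * d) with he
  have hen : ‖e‖ ^ 2 = 4 * d ^ 2 := by
    rw [he, PiLp.norm_single, Real.norm_eq_abs, sq_abs]; ring
  have hc : Continuous fun z => ENNReal.ofReal (‖fderiv ℝ g z‖ ^ 2) := by
    have := hg.continuous_fderiv (by simp)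
    exact ENNReal.continuous_ofReal.comp (by fun_prop)
  have hpt : ∀ y ∈ cube x d, ENNReal.ofReal (‖g y‖ ^ 2) ≤ ENNReal.ofReal (4 * d ^ 2) *
      ∫⁻ t in Set.Icc (0 : ℝ) 1, ENNReal.ofReal (‖fderiv ℝ g (y - t • e)‖ ^ 2) := by
    intro y hy
    have h0 : g (y - e) = 0 := by
      by_contra h
      have h1 := hgs (subset_tsupport _ h) ⟨0, hn⟩
      have h2 := hy ⟨0, hn⟩
      simp only [he, PiLp.sub_apply, PiLp.single_apply, if_true] at h1
      rw [abs_lt] at h1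
      rw [abs_le] at h2
      linarith [h1.1, h2.2]
    have := sq_sub_le_lintegral_segment hg y (y - e)
    rw [h0, sub_zero, sub_sub_cancel, hen] at this
    rw [Real.norm_eq_abs, sq_abs]
    refine this.trans_eq ?_
    congr 1
    refine lintegral_congr fun t => ?_
    congr 4
    rw [smul_sub, sub_smul, one_smul]
    abel
  calc ∫⁻ y in cube x d, ENNReal.ofReal (‖g y‖ ^ 2)
      ≤ ∫⁻ y in cube x d, ENNReal.ofReal (4 * d ^ 2) *
        ∫⁻ t in Set.Icc (0 : ℝ) 1, ENNReal.ofReal (‖fderiv ℝ g (y - t • e)‖ ^ 2) :=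
        setLIntegral_mono' (measurableSet_cube x d) hpt
    _ ≤ ∫⁻ y, ENNReal.ofReal (4 * d ^ 2) *
        ∫⁻ t in Set.Icc (0 : ℝ) 1, ENNReal.ofReal (‖fderiv ℝ g (y - t • e)‖ ^ 2) :=
        setLIntegral_le_lintegral _ _
    _ = ENNReal.ofReal (4 * d ^ 2) * ∫⁻ t in Set.Icc (0 : ℝ) 1,
        ∫⁻ y, ENNReal.ofReal (‖fderiv ℝ g (y - t • e)‖ ^ 2) := by
        rw [lintegral_const_mul' _ _ ENNReal.ofReal_ne_top, lintegral_lintegral_swap]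
        exact (hc.comp (by fun_prop : Continuous fun p : E n × ℝ => p.1 - p.2 • e)).aemeasurable
    _ = ENNReal.ofReal (4 * d ^ 2) * ∫⁻ y, ENNReal.ofReal (‖fderiv ℝ g y‖ ^ 2) := by
        simp_rw [lintegral_sub_right_eq_self (fun z => ENNReal.ofReal (‖fderiv ℝ g z‖ ^ 2))]
        simp
    _ ≤ _ := by
        gcongr
        exact lintegral_sq_norm_fderiv_le_dirichlet g

/-! ### Capacity: smooth potentials and cubes -/

/-- The domain relative to which the capacity of subsets of `Q_d` is taken. -/
def capDomain (x : E n) (d : ℝ) : Set (E n) := if n = 2 then openCube x (2 * d) else Set.univ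

theorem cap_eq (x : E n) (d : ℝ) (F : Set (E n)) : cap x d F = capacity (capDomain x d) F := by
  unfold cap capDomain
  split_ifs <;> rfl

theorem isOpen_capDomain (x : E n) (d : ℝ) : IsOpen (capDomain x d) := by
  unfold capDomain
  split_ifs
  exacts [isOpen_openCube _ _, isOpen_univ]

theorem openCube_subset_capDomain (x : E n) (d : ℝ) : openCube x (2 * d) ⊆ capDomain x d := by
  unfold capDomain
  split_ifs
  exacts [subset_rfl, Set.subset_univ _]

theorem lintegral_sq_cube_le_dirichlet (hn : 2 ≤ n) : ∃ C : ℝ, 0 < C ∧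
    ∀ (x : E n) (d : ℝ), 0 < d → ∀ g : E n → ℝ, ContDiff ℝ 1 g → HasCompactSupport g →
      tsupport g ⊆ capDomain x d →
      ∫⁻ y in cube x d, ENNReal.ofReal (‖g y‖ ^ 2) ≤ ENNReal.ofReal (C * d ^ 2) * dirichlet g := by
  rcases eq_or_ne n 2 with h | h
  · refine ⟨4, by norm_num, fun x d hd g hg _ hgs => ?_⟩
    rw [capDomain, if_pos h] at hgs
    exact lintegral_sq_cube_le_of_tsupport_subset (by omega) x hd hg hgs
  · obtain ⟨C, hC, H⟩ := lintegral_sq_cube_le_of_three_le (n := n) (by omega)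
    exact ⟨C, hC, fun x d hd g hg hgc _ => H x d hd g hg hgc⟩

theorem abs_clamp_sub_clamp_le (z w : ℂ) :
    ‖max 0 (min 1 z.re) - max 0 (min 1 w.re)‖ ≤ ‖z - w‖ := by
  rw [Real.norm_eq_abs]
  calc |max 0 (min 1 z.re) - max 0 (min 1 w.re)| ≤ |min 1 z.re - min 1 w.re| := by
        rw [max_comm, max_comm 0]; exact abs_max_sub_max_le_abs _ _ _
    _ ≤ |z.re - w.re| := by
        rcases le_total 1 z.re with h | h <;> rcases le_total 1 w.re with h' | h' <;>
          simp only [h, h', min_eq_left, min_eq_right, abs_le] <;>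
          constructor <;> rcases abs_cases (z.re - w.re) with h2 | h2 <;> linarith
    _ ≤ ‖z - w‖ := by rw [← Complex.sub_re]; exact Complex.abs_re_le_norm _

/-- Smooth almost-minimisers for the capacity. -/
theorem exists_smooth_potential {x : E n} {d : ℝ} {F : Set (E n)} {A : ℝ≥0∞}
    (hA : cap x d F < A) {δ : ℝ} (hδ : 0 < δ) :
    ∃ g : E n → ℝ, ContDiff ℝ ∞ g ∧ HasCompactSupport g ∧ tsupport g ⊆ capDomain x d ∧
      (∀ y, 0 ≤ g y) ∧ (∀ y, g y ≤ 1) ∧ (∀ y ∈ F, 1 - δ ≤ g y) ∧ dirichlet g < A := by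
  rw [cap_eq, capacity] at hA
  simp only [iInf_lt_iff] at hA
  obtain ⟨P, ⟨⟨K, hK⟩, hPc, hPs, hP1⟩, hPA⟩ := hA
  -- Clamping the real part is a contraction, so it does not increase directional derivatives; it
  -- keeps the value 1 on `F` and does not enlarge the support.
  set f : E n → ℝ := fun y => max 0 (min 1 (P y).re) with hf
  have hle : ∀ y z, ‖f y - f z‖ ≤ ‖P y - P z‖ := fun y z => abs_clamp_sub_clamp_le _ _
  have hfK : LipschitzWith K f := by
    refine LipschitzWith.of_dist_le_mul fun y z => ?_
    rw [dist_eq_norm]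
    exact (hle y z).trans (by simpa [dist_eq_norm] using hK.dist_le_mul y z)
  have hsupp : Function.support f ⊆ Function.support P := by
    intro y hy h
    simp [hf, h] at hy
  have hfc : HasCompactSupport f := hPc.mono hsupp
  have hfd : dirichlet f ≤ ∫⁻ y, ENNReal.ofReal (∑ j, ‖partialD P j y‖ ^ 2) := by
    refine lintegral_mono_ae ?_
    filter_upwards [hfK.ae_differentiableAt, hK.ae_differentiableAt] with y h1 h2
    refine ENNReal.ofReal_le_ofReal (Finset.sum_le_sum fun j _ => ?_)
    gcongr
    exact norm_fderiv_apply_le_of_dist_le h1 h2 hle _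
  obtain ⟨g, hg, hgc, hgs, hg0, hg1, hgf, hgd⟩ := exists_smooth_approx_dirichlet_le hfK hfc
    (fun y => le_max_left _ _) (fun y => max_le zero_le_one (min_le_left _ _))
    (isOpen_capDomain x d) ((closure_mono hsupp).trans hPs) hδ
  refine ⟨g, hg, hgc, hgs, hg0, hg1, fun y hy => ?_, hgd.trans_lt (hfd.trans_lt hPA)⟩
  have h1 : f y = 1 := by simp [hf, hP1 y hy]
  have := abs_le.1 (hgf y)
  linarith [this.1]

theorem partialD_ofReal {g : E n → ℝ} (hg : Differentiable ℝ g) (j : Fin n) (y : E n) :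
    partialD (fun z => (g z : ℂ)) j y = (fderiv ℝ g y (EuclideanSpace.single j 1) : ℝ) := by
  have := (Complex.ofRealCLM.hasFDerivAt (x := g y)).comp y (hg y).hasFDerivAt
  have h2 : HasFDerivAt (fun z => (g z : ℂ)) (Complex.ofRealCLM.comp (fderiv ℝ g y)) y := this
  simp [partialD, h2.fderiv]

theorem cap_le_dirichlet {x : E n} {d : ℝ} {F : Set (E n)} {g : E n → ℝ} (hg : ContDiff ℝ 1 g)
    (hgc : HasCompactSupport g) (hgs : tsupport g ⊆ openCube x (2 * d)) (hg1 : ∀ y ∈ F, g y = 1) :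
    cap x d F ≤ dirichlet g := by
  rw [cap_eq, capacity]
  have hsupp : Function.support (fun y => (g y : ℂ)) ⊆ Function.support g := fun y hy h => by
    simp [h] at hy
  have hcc : HasCompactSupport (fun y => (g y : ℂ)) := hgc.mono hsupp
  have hlip := ContDiff.lipschitzWith_of_hasCompactSupport hcc (Complex.ofRealCLM.contDiff.comp hg)
      one_ne_zero
  refine (iInf₂_le (fun y => (g y : ℂ)) ⟨hlip, hcc, (closure_mono hsupp).trans
    (hgs.trans (openCube_subset_capDomain x d)), fun y hy => by simp [hg1 y hy]⟩).trans_eq ?_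
  refine lintegral_congr fun y => ?_
  simp [partialD_ofReal (hg.differentiable one_ne_zero)]

theorem dirichlet_le_of_tsupport_subset {x : E n} {r C : ℝ} {g : E n → ℝ} (hr : 0 ≤ r)
    (hgs : tsupport g ⊆ cube x r) (hC : ∀ y, ‖fderiv ℝ g y‖ ≤ C) :
    dirichlet g ≤ ENNReal.ofReal (n * C ^ 2 * r ^ n) := by
  have h0 : ∀ y, y ∉ cube x r → fderiv ℝ g y = 0 := fun y hy =>
    image_eq_zero_of_notMem_tsupport fun h => hy (hgs (tsupport_fderiv_subset ℝ h))
  calc dirichlet g ≤ ∫⁻ y, (cube x r).indicator (fun _ => ENNReal.ofReal (n * C ^ 2)) y := by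
        refine lintegral_mono fun y => ?_
        by_cases hy : y ∈ cube x r
        · rw [Set.indicator_of_mem hy]
          refine ENNReal.ofReal_le_ofReal ?_
          calc _ ≤ ∑ _j : Fin n, C ^ 2 := by
                refine Finset.sum_le_sum fun j _ => ?_
                gcongr
                refine ((fderiv ℝ g y).le_opNorm _).trans ?_
                simpa using hC y
            _ = _ := by simp
        · simp [Set.indicator_of_notMem hy, h0 y hy]
    _ = _ := by
        rw [lintegral_indicator (measurableSet_cube x r), lintegral_const,
          Measure.restrict_apply_univ, volume_cube x hr, ← ENNReal.ofReal_mul (by positivity)]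

theorem cap_cube_le (n : ℕ) : ∃ C : ℝ, 0 < C ∧ ∀ (x : E n) (d : ℝ), 0 < d →
    cap x d (cube x d) ≤ ENNReal.ofReal (C * (d ^ n / d ^ 2)) := by
  obtain ⟨C, hC, H⟩ := exists_cutoff n
  refine ⟨n * C ^ 2 * 2 ^ n + 1, by positivity, fun x d hd => ?_⟩
  obtain ⟨χ, hχ, hχc, hχs, -, -, hχ1, hχd⟩ := H x d hd
  refine (cap_le_dirichlet (hχ.of_le (by simp)) hχc hχs hχ1).trans ?_
  refine (dirichlet_le_of_tsupport_subset (by positivity) (hχs.trans (openCube_subset_cube _ _))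
    hχd).trans (ENNReal.ofReal_le_ofReal ?_)
  calc (n : ℝ) * (C / d) ^ 2 * (2 * d) ^ n = (n * C ^ 2 * 2 ^ n) * (d ^ n / d ^ 2) := by
        rw [mul_pow, div_pow]; field_simp
    _ ≤ _ := by gcongr; linarith

/-- A potential that is at least 1/2 on `Q_d` has mass at least `d^n/4` there, while that mass is at
most `C d²` times its Dirichlet integral. With `cap_cube_le`, the capacity of `Q_d` is of order
`d^{n-2}`. -/
theorem le_cap_cube (hn : 2 ≤ n) : ∃ c : ℝ, 0 < c ∧ ∀ (x : E n) (d : ℝ), 0 < d →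
    ENNReal.ofReal (c * (d ^ n / d ^ 2)) ≤ cap x d (cube x d) := by
  obtain ⟨C, hC, H⟩ := lintegral_sq_cube_le_dirichlet hn
  refine ⟨(4 * C)⁻¹, by positivity, fun x d hd => ?_⟩
  by_contra! hlt
  obtain ⟨g, hg, hgc, hgs, hg0, -, hg1, hgd⟩ := exists_smooth_potential hlt (δ := 1 / 2) (by norm_num)
  have h1 := H x d hd g (hg.of_le (by simp)) hgc hgs
  have h2 : ENNReal.ofReal (d ^ n / 4) ≤ ∫⁻ y in cube x d, ENNReal.ofReal (‖g y‖ ^ 2) := by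
    calc ENNReal.ofReal (d ^ n / 4) = ∫⁻ _y in cube x d, ENNReal.ofReal (1 / 4) := by
          rw [lintegral_const, Measure.restrict_apply_univ, volume_cube x hd.le,
            ← ENNReal.ofReal_mul (by norm_num)]
          congr 1; ring
      _ ≤ _ := by
          refine setLIntegral_mono' (measurableSet_cube x d) fun y hy => ENNReal.ofReal_le_ofReal ?_
          have := hg1 y hy
          rw [Real.norm_eq_abs, sq_abs]
          nlinarith
  have h3 : ENNReal.ofReal (C * d ^ 2) * dirichlet g <
      ENNReal.ofReal (C * d ^ 2) * ENNReal.ofReal ((4 * C)⁻¹ * (d ^ n / d ^ 2)) :=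
    ENNReal.mul_lt_mul_right (by simpa using by positivity) ENNReal.ofReal_ne_top hgd
  rw [← ENNReal.ofReal_mul (by positivity)] at h3
  refine absurd (h2.trans_lt (h1.trans_lt h3)) (not_lt.2 (ENNReal.ofReal_le_ofReal ?_))
  apply le_of_eq
  field_simp

/-! ### The form as a norm in a power of L²(Ω) -/

/-- The standing assumptions on the domain and the potentials. -/
structure FormData (Ω : Set (E n)) (a : E n → E n) (V : E n → ℝ) : Prop where
  isOpen : IsOpen Ω
  memLp : ∀ K : Set (E n), IsCompact K → K ⊆ Ω → MemLp a 2 ((volume : Measure (E n)).restrict K)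
  locallyIntegrable : LocallyIntegrableOn V Ω (volume : Measure (E n))
  nonneg : ∀ᵐ x ∂((volume : Measure (E n)).restrict Ω), 0 ≤ V x

theorem partialD_add {u v : E n → ℂ} (hu : Differentiable ℝ u) (hv : Differentiable ℝ v)
    (j : Fin n) (x : E n) :
    partialD (fun y => u y + v y) j x = partialD u j x + partialD v j x := by
  simp [partialD, fderiv_fun_add (hu x) (hv x)]

theorem partialD_const_mul {u : E n → ℂ} (hu : Differentiable ℝ u) (c : ℂ) (j : Fin n) (x : E n) :
    partialD (fun y => c * u y) j x = c * partialD u j x := by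
  simp [partialD, fderiv_const_mul (hu x) c]

theorem magD_add (a : E n → E n) {u v : E n → ℂ} (hu : Differentiable ℝ u)
    (hv : Differentiable ℝ v) (j : Fin n) (x : E n) :
    magD a (fun y => u y + v y) j x = magD a u j x + magD a v j x := by
  simp only [magD, partialD_add hu hv]; ring

theorem magD_const_mul (a : E n → E n) {u : E n → ℂ} (hu : Differentiable ℝ u) (c : ℂ) (j : Fin n)
    (x : E n) : magD a (fun y => c * u y) j x = c * magD a u j x := by
  simp only [magD, partialD_const_mul hu]; ring

namespace IsTest

variable {Ω : Set (E n)} {φ ψ : E n → ℂ}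

theorem differentiable (h : IsTest Ω φ) : Differentiable ℝ φ := h.smooth.differentiable (by simp)

theorem continuous (h : IsTest Ω φ) : Continuous φ := h.smooth.continuous

theorem add (h : IsTest Ω φ) (h' : IsTest Ω ψ) : IsTest Ω (fun x => φ x + ψ x) where
  smooth := h.smooth.add h'.smooth
  compactSupport := h.compactSupport.add h'.compactSupport
  support_subset := (tsupport_add φ ψ).trans (Set.union_subset h.support_subset h'.support_subset)

theorem const_mul (h : IsTest Ω φ) (c : ℂ) : IsTest Ω (fun x => c * φ x) where
  smooth := contDiff_const.mul h.smooth
  compactSupport := h.compactSupport.mul_left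
  support_subset := (tsupport_mul_subset_right (f := fun _ => c)).trans h.support_subset

theorem sub (h : IsTest Ω φ) (h' : IsTest Ω ψ) : IsTest Ω (fun x => φ x - ψ x) := by
  simpa [sub_eq_add_neg] using h.add (h'.const_mul (-1))

theorem zero : IsTest Ω (fun _ => 0) where
  smooth := contDiff_const
  compactSupport := HasCompactSupport.zero
  support_subset := by simp [tsupport]

end IsTest

/-- The components `φ`, `√V φ`, `(∇ₐφ)ⱼ` of a function in the form domain. -/
def formComp (a : E n → E n) (V : E n → ℝ) (φ : E n → ℂ) : Option (Option (Fin n)) → E n → ℂ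
  | none => φ
  | some none => fun x => (Real.sqrt (V x) : ℂ) * φ x
  | some (some j) => magD a φ j

theorem formComp_add (a : E n → E n) (V : E n → ℝ) {φ ψ : E n → ℂ} (hφ : Differentiable ℝ φ)
    (hψ : Differentiable ℝ ψ) (i : Option (Option (Fin n))) (x : E n) :
    formComp a V (fun y => φ y + ψ y) i x = formComp a V φ i x + formComp a V ψ i x := by
  rcases i with _ | _ | j
  · rfl
  · simp only [formComp]; ring
  · exact magD_add a hφ hψ j x

theorem formComp_const_mul (a : E n → E n) (V : E n → ℝ) {φ : E n → ℂ} (hφ : Differentiable ℝ φ)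
    (c : ℂ) (i : Option (Option (Fin n))) (x : E n) :
    formComp a V (fun y => c * φ y) i x = c * formComp a V φ i x := by
  rcases i with _ | _ | j
  · rfl
  · simp only [formComp]; ring
  · exact magD_const_mul a hφ c j x

namespace FormData

variable {Ω : Set (E n)} {a : E n → E n} {V : E n → ℝ} {φ ψ : E n → ℂ}

theorem memLp_mul_of_tsupport (hφc : Continuous φ) (hφs : HasCompactSupport φ) {b : E n → ℂ}
    (hb : MemLp b 2 (volume.restrict (tsupport φ))) : MemLp (fun x => b x * φ x) 2 volume := by
  have h1 : MemLp ((tsupport φ).indicator b) 2 volume :=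
    (memLp_indicator_iff_restrict (isClosed_tsupport φ).measurableSet).2 hb
  have h2 : MemLp φ ⊤ volume := hφc.memLp_of_hasCompactSupport hφs
  refine (memLp_congr_ae (Eventually.of_forall fun x => ?_)).1 (h2.mul h1 (r := 2))
  by_cases hx : x ∈ tsupport φ
  · simp [hx]
  · simp [image_eq_zero_of_notMem_tsupport hx]

theorem memLp_magD (P : FormData Ω a V) (hφ : IsTest Ω φ) (j : Fin n) :
    MemLp (magD a φ j) 2 volume := by
  have h1 : MemLp (partialD φ j) 2 volume := by
    refine Continuous.memLp_of_hasCompactSupport ?_ (hφ.compactSupport.fderiv_apply (𝕜 := ℝ) _)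
    exact (hφ.smooth.continuous_fderiv (by simp)).clm_apply continuous_const
  have h2 : MemLp (fun x => Complex.I * (a x j : ℂ)) 2 (volume.restrict (tsupport φ)) := by
    refine MemLp.const_mul ?_ _
    have := P.memLp _ hφ.compactSupport hφ.support_subset
    exact ((this.continuousLinearMap_comp (EuclideanSpace.proj (𝕜 := ℝ) j))).ofReal
  exact h1.add (memLp_mul_of_tsupport hφ.continuous hφ.compactSupport h2)

theorem ae_restrict_of_subset (P : FormData Ω a V) {K : Set (E n)} (hK : K ⊆ Ω) :
    ∀ᵐ x ∂((volume : Measure (E n)).restrict K), 0 ≤ V x :=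
  ae_restrict_of_ae_restrict_of_subset hK P.nonneg

theorem integrableOn_compact (P : FormData Ω a V) {K : Set (E n)} (hKc : IsCompact K)
    (hK : K ⊆ Ω) : IntegrableOn V K volume :=
  P.locallyIntegrable.integrableOn_compact_subset hK hKc

theorem memLp_sqrt (P : FormData Ω a V) (hφ : IsTest Ω φ) :
    MemLp (fun x => (Real.sqrt (V x) : ℂ) * φ x) 2 volume := by
  refine memLp_mul_of_tsupport hφ.continuous hφ.compactSupport ?_
  have hi := P.integrableOn_compact hφ.compactSupport hφ.support_subset
  refine MemLp.ofReal ?_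
  refine (memLp_two_iff_integrable_sq
    (Real.continuous_sqrt.comp_aestronglyMeasurable hi.aestronglyMeasurable)).2 ?_
  refine (integrable_congr ?_).1 hi
  filter_upwards [P.ae_restrict_of_subset hφ.support_subset] with x hx
  exact (Real.sq_sqrt hx).symm

theorem memLp_formComp (P : FormData Ω a V) (hφ : IsTest Ω φ) (i : Option (Option (Fin n))) :
    MemLp (formComp a V φ i) 2 (volume.restrict Ω) := by
  refine MemLp.restrict _ ?_
  rcases i with _ | _ | j
  · exact hφ.continuous.memLp_of_hasCompactSupport hφ.compactSupport
  · exact P.memLp_sqrt hφ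
  · exact P.memLp_magD hφ j

/-- The vector `(φ, √V φ, ∇ₐφ)` in a power of `L²(Ω)`. -/
def formVec (P : FormData Ω a V) (hφ : IsTest Ω φ) :
    PiLp 2 (fun _ : Option (Option (Fin n)) => L2 Ω) :=
  WithLp.toLp 2 fun i => (P.memLp_formComp hφ i).toLp

theorem formVec_apply (P : FormData Ω a V) (hφ : IsTest Ω φ) (i : Option (Option (Fin n))) :
    P.formVec hφ i = (P.memLp_formComp hφ i).toLp := rfl

theorem formVec_add (P : FormData Ω a V) (hφ : IsTest Ω φ) (hψ : IsTest Ω ψ) :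
    P.formVec (hφ.add hψ) = P.formVec hφ + P.formVec hψ := by
  ext1 i
  rw [PiLp.add_apply, formVec_apply, formVec_apply, formVec_apply, ← MemLp.toLp_add]
  exact MemLp.toLp_congr _ _ (Eventually.of_forall fun x =>
    formComp_add a V hφ.differentiable hψ.differentiable i x)

theorem formVec_const_mul (P : FormData Ω a V) (hφ : IsTest Ω φ) (c : ℂ) :
    P.formVec (hφ.const_mul c) = c • P.formVec hφ := by
  ext1 i
  rw [PiLp.smul_apply, formVec_apply, formVec_apply, ← MemLp.toLp_const_smul]
  exact MemLp.toLp_congr _ _ (Eventually.of_forall fun x =>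
    formComp_const_mul a V hφ.differentiable c i x)

theorem formVec_congr (P : FormData Ω a V) {φ ψ : E n → ℂ} (hφ : IsTest Ω φ) (hψ : IsTest Ω ψ)
    (h : φ = ψ) : P.formVec hφ = P.formVec hψ := by
  subst h; rfl

theorem formVec_sub (P : FormData Ω a V) (hφ : IsTest Ω φ) (hψ : IsTest Ω ψ) :
    P.formVec (hφ.sub hψ) = P.formVec hφ - P.formVec hψ := by
  rw [eq_sub_iff_add_eq, ← formVec_add]
  exact P.formVec_congr _ _ (by funext x; ring)

theorem enorm_toLp_sq {f : E n → ℂ} {μ : Measure (E n)} (hf : MemLp f 2 μ) :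
    ENNReal.ofReal (‖hf.toLp‖ ^ 2) = ∫⁻ y, ENNReal.ofReal (‖f y‖ ^ 2) ∂μ := by
  rw [← eLpNorm_two_sq_eq, Lp.norm_toLp, ENNReal.ofReal_pow ENNReal.toReal_nonneg,
    ENNReal.ofReal_toReal hf.eLpNorm_ne_top]

theorem norm_formVec_sq (P : FormData Ω a V) (hφ : IsTest Ω φ) :
    ‖P.formVec hφ‖ ^ 2 = ‖P.formVec hφ none‖ ^ 2 + ∑ i, ‖P.formVec hφ (some i)‖ ^ 2 := by
  rw [PiLp.norm_sq_eq_of_L2, Fintype.sum_option]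

/-- The components other than `none` carry exactly `√V φ` and `∇ₐφ`; so convergence for the form
together with `L²` convergence is convergence of these vectors. -/
theorem energy_eq (P : FormData Ω a V) (hφ : IsTest Ω φ) :
    energy Ω a V φ = ENNReal.ofReal (‖P.formVec hφ‖ ^ 2 - ‖P.formVec hφ none‖ ^ 2) := by
  rw [norm_formVec_sq, add_sub_cancel_left, ENNReal.ofReal_sum_of_nonneg fun _ _ => by positivity]
  simp_rw [formVec_apply, enorm_toLp_sq]
  rw [← lintegral_finsetSum' _ fun i _ =>
    ((P.memLp_formComp hφ (some i)).1.norm.aemeasurable.pow_const 2).ennreal_ofReal]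
  refine lintegral_congr_ae ?_
  filter_upwards [P.nonneg] with x hx
  rw [← ENNReal.ofReal_sum_of_nonneg fun _ _ => by positivity, Fintype.sum_option]
  simp only [formComp, norm_mul, mul_pow]
  rw [Complex.norm_real, Real.norm_eq_abs, sq_abs, Real.sq_sqrt hx, add_comm]

theorem sesqForm_eq (P : FormData Ω a V) (hφ : IsTest Ω φ) (hψ : IsTest Ω ψ) :
    sesqForm Ω a V φ ψ = inner ℂ (P.formVec hψ) (P.formVec hφ)
      - inner ℂ (P.formVec hψ none) (P.formVec hφ none) := by
  rw [PiLp.inner_apply, Fintype.sum_option, add_sub_cancel_left]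
  simp_rw [L2.inner_def]
  rw [← integral_finsetSum _ fun i _ => L2.integrable_inner _ _]
  refine integral_congr_ae ?_
  have hall : ∀ᵐ x ∂(volume.restrict Ω), ∀ i : Option (Fin n),
      P.formVec hφ (some i) x = formComp a V φ (some i) x ∧
      P.formVec hψ (some i) x = formComp a V ψ (some i) x :=
    ae_all_iff.2 fun i =>
      (P.memLp_formComp hφ (some i)).coeFn_toLp.and (P.memLp_formComp hψ (some i)).coeFn_toLp
  filter_upwards [P.nonneg, hall] with x hx h
  simp_rw [fun i => (h i).1, fun i => (h i).2]
  rw [Fintype.sum_option]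
  simp only [formComp, RCLike.inner_apply, map_mul, Complex.conj_ofReal]
  rw [add_comm]
  congr 1
  have : (V x : ℂ) = (Real.sqrt (V x) : ℂ) * (Real.sqrt (V x) : ℂ) := by
    rw [← Complex.ofReal_mul, Real.mul_self_sqrt hx]
  rw [this]; ring

end FormData

/-! ### Strict positivity of the operator and of the form -/

namespace FormData

variable {Ω : Set (E n)} {a : E n → E n} {V : E n → ℝ}

theorem formConverges_of_tendsto (P : FormData Ω a V) {φ : ℕ → E n → ℂ} (hφ : ∀ k, IsTest Ω (φ k))
    {w : PiLp 2 (fun _ : Option (Option (Fin n)) => L2 Ω)}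
    (hw : Tendsto (fun k => P.formVec (hφ k)) atTop (𝓝 w)) :
    FormConverges Ω a V φ (w none) where
  test := hφ
  tendsto_L2 := by
    have h1 : Tendsto (fun k => P.formVec (hφ k) none) atTop (𝓝 (w none)) :=
      ((PiLp.continuous_apply 2 _ none).tendsto w).comp hw
    have h2 := (Lp.tendsto_Lp_iff_tendsto_eLpNorm' _ _).1 h1
    refine h2.congr fun k => eLpNorm_congr_ae ?_
    filter_upwards [(P.memLp_formComp (hφ k) none).coeFn_toLp] with x hx
    rw [Pi.sub_apply, formVec_apply, hx]
    rfl
  cauchy := by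
    have hc : Tendsto (fun p : ℕ × ℕ => ‖P.formVec (hφ p.1) - P.formVec (hφ p.2)‖ ^ 2) atTop
        (𝓝 0) := by
      have := cauchySeq_iff_tendsto_dist_atTop_0.1 hw.cauchySeq
      simpa [dist_eq_norm] using this.pow 2
    have hc' := ENNReal.tendsto_ofReal hc
    rw [ENNReal.ofReal_zero] at hc'
    refine tendsto_of_tendsto_of_tendsto_of_le_of_le tendsto_const_nhds hc' (fun _ => zero_le) ?_
    intro p
    beta_reduce
    rw [P.energy_eq ((hφ p.1).sub (hφ p.2)), formVec_sub P (hφ p.1) (hφ p.2)]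
    exact ENNReal.ofReal_le_ofReal (sub_le_self _ (sq_nonneg _))

/-- The product norm combines the two notions of Cauchy sequence, and the product space is complete.
The limit `w` keeps the limiting gradient alongside `u`, so closability of the form never has to be
invoked. -/
theorem exists_tendsto_of_formConverges (P : FormData Ω a V) {φ : ℕ → E n → ℂ} {u : L2 Ω}
    (h : FormConverges Ω a V φ u) :
    ∃ w : PiLp 2 (fun _ : Option (Option (Fin n)) => L2 Ω),
      Tendsto (fun k => P.formVec (h.test k)) atTop (𝓝 w) ∧ w none = u := by
  have h1 : Tendsto (fun k => P.formVec (h.test k) none) atTop (𝓝 u) := by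
    refine (Lp.tendsto_Lp_iff_tendsto_eLpNorm' _ _).2 (h.tendsto_L2.congr fun k => ?_)
    refine eLpNorm_congr_ae ?_
    filter_upwards [(P.memLp_formComp (h.test k) none).coeFn_toLp] with x hx
    rw [Pi.sub_apply, formVec_apply, hx]
    rfl
  have hcs : CauchySeq fun k => P.formVec (h.test k) := by
    rw [cauchySeq_iff_tendsto_dist_atTop_0]
    have e1 : Tendsto (fun p : ℕ × ℕ => ‖P.formVec (h.test p.1) none - P.formVec (h.test p.2) none‖ ^ 2)
        atTop (𝓝 0) := by
      have := cauchySeq_iff_tendsto_dist_atTop_0.1 h1.cauchySeq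
      simpa [dist_eq_norm] using this.pow 2
    have e2 := (ENNReal.tendsto_toReal ENNReal.zero_ne_top).comp h.cauchy
    have e3 := (e1.add e2).sqrt
    simp only [ENNReal.toReal_zero, add_zero, Real.sqrt_zero] at e3
    refine e3.congr fun p => ?_
    have hn : ‖P.formVec ((h.test p.1).sub (h.test p.2)) none‖ ^ 2
        ≤ ‖P.formVec ((h.test p.1).sub (h.test p.2))‖ ^ 2 := by
      rw [norm_formVec_sq]
      exact le_add_of_nonneg_right (by positivity)
    rw [Function.comp_apply, P.energy_eq ((h.test p.1).sub (h.test p.2)), ENNReal.toReal_ofReal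
      (sub_nonneg.2 hn), formVec_sub, PiLp.sub_apply, add_sub_cancel, dist_eq_norm,
      Real.sqrt_sq (norm_nonneg _)]
  obtain ⟨w, hw⟩ := cauchySeq_tendsto_of_complete hcs
  exact ⟨w, hw, tendsto_nhds_unique (((PiLp.continuous_apply 2 _ none).tendsto w).comp hw) h1⟩

theorem integral_mul_conj_eq_inner (P : FormData Ω a V) (f : L2 Ω) {ψ : E n → ℂ}
    (hψ : IsTest Ω ψ) : ∫ x in Ω, f x * conj (ψ x) = inner ℂ (P.formVec hψ none) f := by
  rw [L2.inner_def]
  refine integral_congr_ae ?_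
  filter_upwards [(P.memLp_formComp hψ none).coeFn_toLp] with x hx
  rw [formVec_apply, hx, RCLike.inner_apply]
  rfl

/-- The set of the vectors `(φ, √V φ, ∇ₐφ)` of test functions. -/
def formSpace (P : FormData Ω a V) :
    Submodule ℂ (PiLp 2 (fun _ : Option (Option (Fin n)) => L2 Ω)) where
  carrier := {w | ∃ (φ : E n → ℂ) (hφ : IsTest Ω φ), P.formVec hφ = w}
  add_mem' := by
    rintro _ _ ⟨φ, hφ, rfl⟩ ⟨ψ, hψ, rfl⟩
    exact ⟨_, hφ.add hψ, P.formVec_add hφ hψ⟩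
  zero_mem' := ⟨_, (IsTest.zero (Ω := Ω)).const_mul 0, by
    rw [formVec_const_mul P IsTest.zero, zero_smul]⟩
  smul_mem' := by
    rintro c _ ⟨φ, hφ, rfl⟩
    exact ⟨_, hφ.const_mul c, P.formVec_const_mul hφ c⟩

/-- The hypothesis is the weak form of `(H+1)u = f` with `u = w none`, since the inner product of
the full vectors is the form plus the `L²` product. -/
theorem operatorGraph_of_mem_closure (P : FormData Ω a V) {f : L2 Ω}
    {w : PiLp 2 (fun _ : Option (Option (Fin n)) => L2 Ω)}
    (hw : w ∈ closure (P.formSpace : Set (PiLp 2 (fun _ : Option (Option (Fin n)) => L2 Ω))))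
    (h : ∀ (ψ : E n → ℂ) (hψ : IsTest Ω ψ),
      inner ℂ (P.formVec hψ) w = inner ℂ (P.formVec hψ none) f) :
    OperatorGraph Ω a V (w none) (f - w none) := by
  obtain ⟨x, hx, hxw⟩ := mem_closure_iff_seq_limit.1 hw
  choose φ hφ hφx using hx
  obtain rfl : (fun k => P.formVec (hφ k)) = x := funext hφx
  refine ⟨φ, P.formConverges_of_tendsto hφ hxw, fun ψ hψ => ?_⟩
  rw [P.integral_mul_conj_eq_inner _ hψ, inner_sub_right, ← h ψ hψ]
  simp_rw [P.sesqForm_eq (hφ _) hψ]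
  refine (tendsto_const_nhds.inner hxw).sub (tendsto_const_nhds.inner ?_)
  exact ((PiLp.continuous_apply 2 _ none).tendsto w).comp hxw

/-- A duality argument that avoids the spectral theorem. For `f = φ`, the solution `u` of `(H+1)u =
f` obeys `(1+ε)‖u‖ ≤ ‖f‖` by positivity, hence its form vector `w` satisfies `(1+ε)‖w‖² ≤ ‖f‖²`.
Pairing `w` with the vector of `φ` returns `‖f‖²`, and Cauchy–Schwarz gives the claim. -/
theorem norm_sq_le_of_strictlyPositive (P : FormData Ω a V) {ε : ℝ} (hε : 0 < ε)
    (h : ∀ u f : L2 Ω, OperatorGraph Ω a V u f → ε * ‖u‖ ^ 2 ≤ (inner ℂ f u).re)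
    {φ : E n → ℂ} (hφ : IsTest Ω φ) :
    (1 + ε) * ‖P.formVec hφ none‖ ^ 2 ≤ ‖P.formVec hφ‖ ^ 2 := by
  set f := P.formVec hφ none with hf
  set e : PiLp 2 (fun _ : Option (Option (Fin n)) => L2 Ω) := PiLp.single 2 none f with he
  set S := P.formSpace.topologicalClosure with hS
  have hein : ∀ z : PiLp 2 (fun _ : Option (Option (Fin n)) => L2 Ω),
      inner ℂ z e = inner ℂ (z none) f := by
    intro z
    rw [PiLp.inner_apply, Fintype.sum_option]
    simp [he]
  -- The Riesz representative in `S` of the functional `z ↦ ⟨f, z none⟩`, obtained as the orthogonal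
  -- projection of `(f, 0, …, 0)`.
  set w := S.starProjection e with hw
  have hwS : w ∈ S := S.starProjection_apply_mem e
  have hin : ∀ z ∈ S, inner ℂ z w = inner ℂ (z none) f := by
    intro z hz
    have := S.starProjection_inner_eq_zero e z hz
    rw [← hein, ← sub_eq_zero, ← inner_sub_right, ← inner_conj_symm, ← neg_sub, inner_neg_left,
      this]
    simp
  have hmem : ∀ {ψ : E n → ℂ} (hψ : IsTest Ω ψ), P.formVec hψ ∈ S := fun hψ =>
    P.formSpace.le_topologicalClosure ⟨_, hψ, rfl⟩
  have hgraph := P.operatorGraph_of_mem_closure hwS (f := f) fun ψ hψ => hin _ (hmem hψ)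
  have h1 := h _ _ hgraph
  set u := w none with hu
  have h2 : (1 + ε) * ‖u‖ ^ 2 ≤ (inner ℂ f u).re := by
    rw [inner_sub_left, Complex.sub_re] at h1
    have : (inner ℂ u u).re = ‖u‖ ^ 2 := by
      rw [inner_self_eq_norm_sq_to_K]; norm_cast
    linarith
  have h3 : (inner ℂ f u).re ≤ ‖f‖ * ‖u‖ := (Complex.re_le_norm _).trans (norm_inner_le_norm _ _)
  have h4 : ‖w‖ ^ 2 = (inner ℂ f u).re := by
    have := hin w hwS
    rw [inner_self_eq_norm_sq_to_K] at this
    have h5 := congrArg Complex.re this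
    rw [← inner_conj_symm f u, Complex.conj_re, ← h5]
    norm_cast
  have h6 : ‖f‖ ^ 2 ≤ ‖P.formVec hφ‖ * ‖w‖ := by
    have := hin _ (hmem hφ)
    rw [← hf, inner_self_eq_norm_sq_to_K] at this
    calc ‖f‖ ^ 2 = ‖inner ℂ (P.formVec hφ) w‖ := by rw [this]; simp
      _ ≤ _ := norm_inner_le_norm _ _
  have hf0 := norm_nonneg f
  have hu0 := norm_nonneg u
  have h7 : (1 + ε) * ‖u‖ ≤ ‖f‖ := by
    rcases hu0.eq_or_lt with h0 | h0
    · rw [← h0, mul_zero]; exact hf0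
    · refine le_of_mul_le_mul_right ?_ h0
      nlinarith
  have h8 : (1 + ε) * ‖w‖ ^ 2 ≤ ‖f‖ ^ 2 := by nlinarith
  rcases hf0.eq_or_lt with h0 | h0
  · rw [← h0]; simp
  have h9 : (‖f‖ ^ 2) ^ 2 ≤ ‖P.formVec hφ‖ ^ 2 * ‖w‖ ^ 2 := by
    rw [← mul_pow]; gcongr
  have h10 : (0 : ℝ) < ‖f‖ ^ 2 := by positivity
  refine le_of_mul_le_mul_right ?_ h10
  nlinarith [sq_nonneg ‖P.formVec hφ‖]

theorem strictlyPositive_iff (P : FormData Ω a V) :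
    StrictlyPositive Ω a V ↔ ∃ ε : ℝ, 0 < ε ∧ ∀ φ : E n → ℂ, IsTest Ω φ →
      ENNReal.ofReal ε * ∫⁻ y in Ω, ENNReal.ofReal (‖φ y‖ ^ 2) ≤ energy Ω a V φ := by
  have key : ∀ ε : ℝ, 0 < ε → ∀ (φ : E n → ℂ) (hφ : IsTest Ω φ),
      (ENNReal.ofReal ε * ∫⁻ y in Ω, ENNReal.ofReal (‖φ y‖ ^ 2) ≤ energy Ω a V φ ↔
        (1 + ε) * ‖P.formVec hφ none‖ ^ 2 ≤ ‖P.formVec hφ‖ ^ 2) := by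
    intro ε hε φ hφ
    rw [P.energy_eq hφ, show ∫⁻ y in Ω, ENNReal.ofReal (‖φ y‖ ^ 2)
      = ENNReal.ofReal (‖P.formVec hφ none‖ ^ 2) from
      (enorm_toLp_sq (P.memLp_formComp hφ none)).symm,
      ← ENNReal.ofReal_mul hε.le, ENNReal.ofReal_le_ofReal_iff]
    · rw [le_sub_iff_add_le]
      ring_nf
    · rw [norm_formVec_sq, add_sub_cancel_left]
      positivity
  constructor
  · rintro ⟨ε, hε, h⟩
    exact ⟨ε, hε, fun φ hφ => (key ε hε φ hφ).2 (P.norm_sq_le_of_strictlyPositive hε h hφ)⟩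
  · rintro ⟨ε, hε, h⟩
    refine ⟨ε, hε, ?_⟩
    rintro u f ⟨φ, hφ, hlim⟩
    obtain ⟨w, hw, rfl⟩ := P.exists_tendsto_of_formConverges hφ
    have hw0 : Tendsto (fun k => P.formVec (hφ.test k) none) atTop (𝓝 (w none)) :=
      ((PiLp.continuous_apply 2 _ none).tendsto w).comp hw
    have h1 : (1 + ε) * ‖w none‖ ^ 2 ≤ ‖w‖ ^ 2 :=
      le_of_tendsto_of_tendsto' ((hw0.norm.pow 2).const_mul _) (hw.norm.pow 2) fun k =>
        (key ε hε _ (hφ.test k)).1 (h _ (hφ.test k))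
    -- The weak equation is tested with the approximating functions themselves; letting `m → ∞` next
    -- identifies `⟨u, f⟩` with `‖w‖² - ‖u‖²`, the closed form at `u`.
    have h2 : ∀ m, inner ℂ (P.formVec (hφ.test m) none) f =
        inner ℂ (P.formVec (hφ.test m)) w - inner ℂ (P.formVec (hφ.test m) none) (w none) := by
      intro m
      have l1 := hlim _ (hφ.test m)
      rw [P.integral_mul_conj_eq_inner _ (hφ.test m)] at l1
      simp_rw [P.sesqForm_eq (hφ.test _) (hφ.test m)] at l1
      exact tendsto_nhds_unique l1
        ((tendsto_const_nhds.inner hw).sub (tendsto_const_nhds.inner hw0))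
    have h3 : inner ℂ (w none) f = inner ℂ w w - inner ℂ (w none) (w none) := by
      refine tendsto_nhds_unique (hw0.inner tendsto_const_nhds) ?_
      simp_rw [h2]
      exact (hw.inner tendsto_const_nhds).sub (hw0.inner tendsto_const_nhds)
    have h4 := congrArg Complex.re h3
    have h5 : (inner ℂ w w).re = ‖w‖ ^ 2 := inner_self_eq_norm_sq (𝕜 := ℂ) w
    have h6 : (inner ℂ (w none) (w none)).re = ‖w none‖ ^ 2 :=
      inner_self_eq_norm_sq (𝕜 := ℂ) (w none)
    rw [Complex.sub_re, h5, h6] at h4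
    rw [← inner_conj_symm, Complex.conj_re, h4]
    linarith

end FormData

/-! ### Capacity of sublevel sets -/

theorem exists_abs_deriv_smoothTransition_le :
    ∃ C : ℝ, 0 < C ∧ ∀ t, |deriv Real.smoothTransition t| ≤ C := by
  have hs : ContDiff ℝ 1 Real.smoothTransition := Real.smoothTransition.contDiff
  have hsupp : HasCompactSupport (deriv Real.smoothTransition) := by
    refine HasCompactSupport.of_support_subset_isCompact (isCompact_Icc (a := (0 : ℝ)) (b := 1)) ?_
    intro t ht
    by_contra h
    rw [Set.mem_Icc, not_and_or, not_le, not_le] at h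
    refine ht ?_
    rcases h with h | h
    · have : Real.smoothTransition =ᶠ[𝓝 t] fun _ => 0 := by
        filter_upwards [Iio_mem_nhds h] with s hs
        exact Real.smoothTransition.zero_of_nonpos (le_of_lt hs)
      rw [this.deriv_eq, deriv_const]
    · have : Real.smoothTransition =ᶠ[𝓝 t] fun _ => 1 := by
        filter_upwards [Ioi_mem_nhds h] with s hs
        exact Real.smoothTransition.one_of_one_le (le_of_lt hs)
      rw [this.deriv_eq, deriv_const]
  obtain ⟨C, hC⟩ := hsupp.exists_bound_of_continuous (hs.continuous_deriv (by simp))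
  exact ⟨max C 1, by positivity, fun t => (hC t).trans (le_max_left _ _)⟩

/-- A smooth function that is `1` where `|φ| ≤ κ / 4` and `0` where `|φ| > κ / 2`. -/
theorem exists_sublevel_cutoff : ∃ C : ℝ, 0 < C ∧ ∀ (n : ℕ) (a : E n → E n) (φ : E n → ℂ) (κ : ℝ),
    ContDiff ℝ ∞ φ → 0 < κ → ∃ w : E n → ℝ, ContDiff ℝ ∞ w ∧ (∀ y, 0 ≤ w y) ∧ (∀ y, w y ≤ 1) ∧
      (∀ y, ‖φ y‖ ≤ κ / 4 → w y = 1) ∧ (∀ y, κ / 2 < ‖φ y‖ → w y = 0) ∧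
      ∀ y j, ‖fderiv ℝ w y (EuclideanSpace.single j 1)‖ ≤ C / κ * ‖magD a φ j y‖ := by
  obtain ⟨C, hC, hCs⟩ := exists_abs_deriv_smoothTransition_le
  refine ⟨16 / 3 * C, by positivity, fun n a φ κ hφ hκ => ?_⟩
  -- Affine in `|φ|²`, hence smooth even at zeros of `φ`; it equals 1 at `|φ| = κ/4` and 0 at `|φ| =
  -- κ/2`.
  set q : E n → ℝ := fun y => 4 / 3 - 16 / (3 * κ ^ 2) * ‖φ y‖ ^ 2 with hq
  have hqs : ContDiff ℝ ∞ q := contDiff_const.sub (contDiff_const.mul (hφ.norm_sq ℝ))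
  have hw0 : ∀ y, κ / 2 < ‖φ y‖ → Real.smoothTransition (q y) = 0 := by
    intro y hy
    refine Real.smoothTransition.zero_of_nonpos ?_
    have : (κ / 2) ^ 2 ≤ ‖φ y‖ ^ 2 := by gcongr
    have h2 : 16 / (3 * κ ^ 2) * (κ / 2) ^ 2 ≤ 16 / (3 * κ ^ 2) * ‖φ y‖ ^ 2 := by gcongr
    have h3 : 16 / (3 * κ ^ 2) * (κ / 2) ^ 2 = 4 / 3 := by field_simp; norm_num
    simp only [hq]; linarith
  refine ⟨fun y => Real.smoothTransition (q y), Real.smoothTransition.contDiff.comp hqs,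
    fun y => Real.smoothTransition.nonneg _, fun y => Real.smoothTransition.le_one _, ?_, hw0, ?_⟩
  · intro y hy
    refine Real.smoothTransition.one_of_one_le ?_
    have : ‖φ y‖ ^ 2 ≤ (κ / 4) ^ 2 := by gcongr
    have h2 : 16 / (3 * κ ^ 2) * ‖φ y‖ ^ 2 ≤ 16 / (3 * κ ^ 2) * (κ / 4) ^ 2 := by gcongr
    have h3 : 16 / (3 * κ ^ 2) * (κ / 4) ^ 2 = 1 / 3 := by field_simp; norm_num
    simp only [hq]; linarith
  · intro y j
    -- Differentiating `|φ|²` produces a factor `|φ|`; it is at most `κ/2` wherever the cutoff is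
    -- not locally zero.
    rcases lt_or_ge (κ / 2) ‖φ y‖ with hy | hy
    · have : (fun y => Real.smoothTransition (q y)) =ᶠ[𝓝 y] fun _ => 0 := by
        filter_upwards [(isOpen_lt continuous_const hφ.continuous.norm).mem_nhds hy] with z hz
        exact hw0 z hz
      rw [this.fderiv_eq]
      simp only [fderiv_fun_const, Pi.zero_apply, zero_apply, norm_zero]
      positivity
    · have h1 := (((hφ.differentiable (by simp)).differentiableAt
        (x := y)).hasFDerivAt.norm_sq.const_mul (16 / (3 * κ ^ 2))).const_sub (4 / 3)
      have h2 : HasDerivAt Real.smoothTransition (deriv Real.smoothTransition (q y)) (q y) :=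
        ((Real.smoothTransition.contDiff (n := 1)).differentiable (by simp)
          |>.differentiableAt).hasDerivAt
      have h3 : fderiv ℝ (fun y => Real.smoothTransition (q y)) y (EuclideanSpace.single j 1)
          = -(deriv Real.smoothTransition (q y) * (32 / (3 * κ ^ 2) *
            inner ℝ (φ y) (magD a φ j y))) := by
        have h4 : HasFDerivAt (fun y => Real.smoothTransition (q y)) _ y := h2.comp_hasFDerivAt y h1
        rw [h4.fderiv, inner_magD]
        simp only [partialD, smul_apply, neg_apply, ContinuousLinearMap.comp_apply, innerSL_apply_apply,
          smul_eq_mul, nsmul_eq_mul]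
        push_cast
        ring
      rw [h3, norm_neg, norm_mul, norm_mul]
      calc _ ≤ C * (‖32 / (3 * κ ^ 2)‖ * (‖φ y‖ * ‖magD a φ j y‖)) := by
            gcongr
            · exact hCs _
            · exact norm_inner_le_norm _ _
        _ ≤ C * (32 / (3 * κ ^ 2) * ((κ / 2) * ‖magD a φ j y‖)) := by
            rw [Real.norm_of_nonneg (by positivity)]
            gcongr
        _ = _ := by field_simp; ring

theorem magD_eq_zero_of_notMem_tsupport (a : E n → E n) {φ : E n → ℂ} {y : E n}
    (hy : y ∉ tsupport φ) (j : Fin n) : magD a φ j y = 0 := by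
  have h1 : fderiv ℝ φ y = 0 :=
    image_eq_zero_of_notMem_tsupport fun h => hy (tsupport_fderiv_subset ℝ h)
  simp [magD, partialD, h1, image_eq_zero_of_notMem_tsupport hy]

namespace FormData

variable {Ω : Set (E n)} {a : E n → E n} {V : E n → ℝ} {φ : E n → ℂ}

theorem ae_mul_nonneg (P : FormData Ω a V) (hφ : ∀ y ∉ Ω, φ y = 0) :
    ∀ᵐ y, 0 ≤ V y * ‖φ y‖ ^ 2 := by
  filter_upwards [(ae_restrict_iff' P.isOpen.measurableSet).1 P.nonneg] with y hy
  by_cases h : y ∈ Ω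
  · exact mul_nonneg (hy h) (sq_nonneg _)
  · simp [hφ y h]

theorem energy_zero_le (P : FormData Ω a V) (hφ : ∀ y ∉ Ω, φ y = 0) (G : Set (E n)) :
    energy G a (fun _ => 0) φ ≤ energy G a V φ := by
  refine lintegral_mono_ae (ae_restrict_of_ae ?_)
  filter_upwards [P.ae_mul_nonneg hφ] with y hy
  refine ENNReal.ofReal_le_ofReal ?_
  linarith

end FormData

theorem lintegral_mul_le_energy (G : Set (E n)) (a : E n → E n) (V : E n → ℝ) (φ : E n → ℂ) :
    ∫⁻ y in G, ENNReal.ofReal (V y * ‖φ y‖ ^ 2) ≤ energy G a V φ :=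
  lintegral_mono fun y => ENNReal.ofReal_le_ofReal (le_add_of_nonneg_left (by positivity))

theorem energy_mono (a : E n → E n) (V : E n → ℝ) (φ : E n → ℂ) {G G' : Set (E n)} (h : G ⊆ G') :
    energy G a V φ ≤ energy G' a V φ := lintegral_mono_set h

/-- Capacity of a sublevel set of a function that is close to a positive constant. -/
theorem cap_sublevel_le (n : ℕ) : ∃ C : ℝ, 0 < C ∧ ∀ (a : E n → E n) (φ : E n → ℂ) (x : E n)
    (d κ A B : ℝ), ContDiff ℝ ∞ φ → 0 < d → 0 < κ → 0 ≤ A → 0 ≤ B →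
    ∫⁻ y in cube x (2 * d), ENNReal.ofReal ((‖φ y‖ - κ) ^ 2) ≤ ENNReal.ofReal A →
    energy (cube x (2 * d)) a (fun _ => 0) φ ≤ ENNReal.ofReal B →
    cap x d {y | y ∈ cube x d ∧ ‖φ y‖ ≤ κ / 4} ≤
      ENNReal.ofReal (C * (A / d ^ 2 + B) / κ ^ 2) := by
  obtain ⟨C₁, hC₁, hcut⟩ := exists_cutoff n
  obtain ⟨C₂, hC₂, hlev⟩ := exists_sublevel_cutoff
  refine ⟨8 * n * C₁ ^ 2 + 2 * C₂ ^ 2, by positivity,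
    fun a φ x d κ A B hφ hd hκ hA hB hIA hEB => ?_⟩
  obtain ⟨χ, hχ, hχc, hχs, hχ0, hχ1, hχQ, hχd⟩ := hcut x d hd
  obtain ⟨w, hw, hw0, hw1, hwl, hwu, hwd⟩ := hlev n a φ κ hφ hκ
  have hsupp : Function.support (fun y => χ y * w y) ⊆ Function.support χ := fun y hy h => by
    simp [h] at hy
  have hts := closure_mono hsupp
  have hQ' : tsupport (fun y => χ y * w y) ⊆ cube x (2 * d) :=
    (hts.trans hχs).trans (openCube_subset_cube _ _)
  refine (cap_le_dirichlet (g := fun y => χ y * w y) ((hχ.mul hw).of_le (by simp)) (hχc.mono hsupp)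
    (hts.trans hχs) ?_).trans ?_
  · rintro y ⟨hy, hy'⟩
    simp [hχQ y hy, hwl y hy']
  have hpt : ∀ y, ENNReal.ofReal (∑ j, ‖fderiv ℝ (fun y => χ y * w y) y
      (EuclideanSpace.single j 1)‖ ^ 2) ≤ (cube x (2 * d)).indicator (fun y =>
        ENNReal.ofReal (8 * n * (C₁ / d) ^ 2 / κ ^ 2) * ENNReal.ofReal ((‖φ y‖ - κ) ^ 2) +
        ENNReal.ofReal (2 * (C₂ / κ) ^ 2) *
          ENNReal.ofReal (∑ j, ‖magD a φ j y‖ ^ 2)) y := by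
    intro y
    by_cases hy : y ∈ cube x (2 * d)
    · rw [Set.indicator_of_mem hy, ← ENNReal.ofReal_mul (by positivity),
        ← ENNReal.ofReal_mul (by positivity), ← ENNReal.ofReal_add (by positivity) (by positivity)]
      refine ENNReal.ofReal_le_ofReal ?_
      -- Where `w` is nonzero, `|φ| ≤ κ/2` and so `||φ| - κ| ≥ κ/2`. Thus the term with `∇χ` is paid
      -- for by the `L²` distance of `|φ|` to `κ`.
      have hwκ : w y ^ 2 ≤ 4 * (‖φ y‖ - κ) ^ 2 / κ ^ 2 := by
        rcases lt_or_ge (κ / 2) ‖φ y‖ with h | h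
        · rw [hwu y h, zero_pow two_ne_zero]; positivity
        · rw [le_div_iff₀ (by positivity)]
          have h1 : w y ^ 2 ≤ 1 := pow_le_one₀ (hw0 y) (hw1 y)
          nlinarith [mul_le_mul_of_nonneg_right h1 (sq_nonneg κ)]
      have hj : ∀ j, ‖fderiv ℝ (fun y => χ y * w y) y (EuclideanSpace.single j 1)‖ ^ 2 ≤
          8 * (C₁ / d) ^ 2 / κ ^ 2 * (‖φ y‖ - κ) ^ 2 + 2 * (C₂ / κ) ^ 2 * ‖magD a φ j y‖ ^ 2 := by
        intro j
        rw [fderiv_fun_mul (hχ.differentiable (by simp)).differentiableAt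
          (hw.differentiable (by simp)).differentiableAt]
        simp only [add_apply, smul_apply, smul_eq_mul,
          Real.norm_eq_abs, sq_abs]
        set p := fderiv ℝ w y (EuclideanSpace.single j 1)
        set s := fderiv ℝ χ y (EuclideanSpace.single j 1)
        have hs : |s| ≤ C₁ / d := by
          refine ((fderiv ℝ χ y).le_opNorm _).trans ?_
          simpa using hχd y
        have hs2 : s ^ 2 ≤ (C₁ / d) ^ 2 := by rw [← sq_abs]; gcongr
        have hp2 : p ^ 2 ≤ (C₂ / κ) ^ 2 * ‖magD a φ j y‖ ^ 2 := by
          rw [← sq_abs p, ← mul_pow]; gcongr; exact hwd y j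
        have hχ2 : χ y ^ 2 ≤ 1 := pow_le_one₀ (hχ0 y) (hχ1 y)
        calc (χ y * p + w y * s) ^ 2 ≤ 2 * (χ y ^ 2 * p ^ 2) + 2 * (w y ^ 2 * s ^ 2) := by
              nlinarith [sq_nonneg (χ y * p - w y * s)]
          _ ≤ 2 * (1 * ((C₂ / κ) ^ 2 * ‖magD a φ j y‖ ^ 2)) +
              2 * ((4 * (‖φ y‖ - κ) ^ 2 / κ ^ 2) * (C₁ / d) ^ 2) := by gcongr
          _ = _ := by ring
      refine (Finset.sum_le_sum fun j _ => hj j).trans (le_of_eq ?_)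
      rw [Finset.sum_add_distrib, Finset.sum_const, Finset.card_univ, Fintype.card_fin,
        nsmul_eq_mul, Finset.mul_sum]
      ring
    · have h0 : fderiv ℝ (fun y => χ y * w y) y = 0 :=
        image_eq_zero_of_notMem_tsupport fun h => hy (hQ' (tsupport_fderiv_subset ℝ h))
      simp [h0]
  calc dirichlet (fun y => χ y * w y) ≤ _ := lintegral_mono hpt
    _ = ENNReal.ofReal (8 * n * (C₁ / d) ^ 2 / κ ^ 2) *
          (∫⁻ y in cube x (2 * d), ENNReal.ofReal ((‖φ y‖ - κ) ^ 2)) +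
        ENNReal.ofReal (2 * (C₂ / κ) ^ 2) * energy (cube x (2 * d)) a (fun _ => 0) φ := by
        have hm : Measurable fun y => ENNReal.ofReal ((‖φ y‖ - κ) ^ 2) := by
          have := hφ.continuous
          exact (ENNReal.continuous_ofReal.comp (by fun_prop)).measurable
        rw [lintegral_indicator (measurableSet_cube _ _), lintegral_add_left (hm.const_mul _),
          lintegral_const_mul' _ _ ENNReal.ofReal_ne_top,
          lintegral_const_mul' _ _ ENNReal.ofReal_ne_top]
        simp [energy]
    _ ≤ ENNReal.ofReal (8 * n * (C₁ / d) ^ 2 / κ ^ 2) * ENNReal.ofReal A +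
        ENNReal.ofReal (2 * (C₂ / κ) ^ 2) * ENNReal.ofReal B := by gcongr
    _ ≤ _ := by
        rw [← ENNReal.ofReal_mul (by positivity), ← ENNReal.ofReal_mul (by positivity),
          ← ENNReal.ofReal_add (by positivity) (by positivity)]
        refine ENNReal.ofReal_le_ofReal ?_
        rw [← sub_nonneg]
        have : (8 * n * C₁ ^ 2 + 2 * C₂ ^ 2) * (A / d ^ 2 + B) / κ ^ 2 -
            (8 * n * (C₁ / d) ^ 2 / κ ^ 2 * A + 2 * (C₂ / κ) ^ 2 * B) =
            (8 * n * C₁ ^ 2 * B + 2 * C₂ ^ 2 * (A / d ^ 2)) / κ ^ 2 := by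
          field_simp; ring
        rw [this]; positivity

/-! ### From the criterion to strict positivity -/

/-- Tonelli with the symmetry `y ∈ Q_d(x) ↔ x ∈ Q_d(y)`. Averaging over all centres replaces a
tiling of space and handles the overlap of the doubled cubes. -/
theorem lintegral_lintegral_cube {f : E n → ℝ≥0∞} (hf : AEMeasurable f) {d : ℝ} (hd : 0 ≤ d) :
    ∫⁻ x, ∫⁻ y in cube x d, f y = ENNReal.ofReal (d ^ n) * ∫⁻ y, f y := by
  have hS : IsClosed {p : E n × E n | p.1 ∈ cube p.2 d} := by
    have : {p : E n × E n | p.1 ∈ cube p.2 d} = ⋂ i, {p | |p.1 i - p.2 i| ≤ d / 2} := by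
      ext p; simp [cube]
    rw [this]
    exact isClosed_iInter fun i => isClosed_le (by fun_prop) continuous_const
  have hsymm : ∀ x y : E n, y ∈ cube x d ↔ x ∈ cube y d := fun x y =>
    forall_congr' fun i => by rw [abs_sub_comm]
  have h1 : ∀ x, ∫⁻ y in cube x d, f y
      = ∫⁻ y, {p : E n × E n | p.1 ∈ cube p.2 d}.indicator (fun p => f p.2) (x, y) := by
    intro x
    rw [← lintegral_indicator (measurableSet_cube x d)]
    refine lintegral_congr fun y => ?_
    by_cases h : y ∈ cube x d
    · rw [Set.indicator_of_mem h, Set.indicator_of_mem (by exact (hsymm x y).1 h)]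
    · have h' : (x, y) ∉ {p : E n × E n | p.1 ∈ cube p.2 d} := fun h' => h ((hsymm x y).2 h')
      rw [Set.indicator_of_notMem h, Set.indicator_of_notMem h']
  simp_rw [h1]
  rw [lintegral_lintegral_swap]
  · rw [← lintegral_const_mul' _ _ ENNReal.ofReal_ne_top]
    refine lintegral_congr fun y => ?_
    have : ∀ x, {p : E n × E n | p.1 ∈ cube p.2 d}.indicator (fun p => f p.2) (x, y)
        = (cube y d).indicator (fun _ => f y) x := fun x => by
      by_cases h : x ∈ cube y d
      · rw [Set.indicator_of_mem h, Set.indicator_of_mem (by exact h)]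
      · rw [Set.indicator_of_notMem h, Set.indicator_of_notMem (by exact h)]
    simp_rw [this]
    rw [lintegral_indicator (measurableSet_cube y d), lintegral_const,
      Measure.restrict_apply_univ, volume_cube y hd, mul_comm]
  · exact (hf.comp_quasiMeasurePreserving Measure.quasiMeasurePreserving_snd).indicator
      hS.measurableSet

theorem IsTest.lintegral_sq_ne_top {Ω : Set (E n)} {φ : E n → ℂ} (hφ : IsTest Ω φ)
    (G : Set (E n)) : ∫⁻ y in G, ENNReal.ofReal (‖φ y‖ ^ 2) ≠ ⊤ := by
  have : MemLp φ 2 (volume.restrict G) :=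
    (hφ.continuous.memLp_of_hasCompactSupport hφ.compactSupport).restrict _
  rw [← FormData.enorm_toLp_sq this]
  exact ENNReal.ofReal_ne_top

theorem IsTest.eq_zero_of_notMem {Ω : Set (E n)} {φ : E n → ℂ} (hφ : IsTest Ω φ) {y : E n}
    (hy : y ∉ Ω) : φ y = 0 :=
  image_eq_zero_of_notMem_tsupport fun h => hy (hφ.support_subset h)

theorem lintegral_sq_norm_le {φ : E n → ℂ} (hφ : Continuous φ) (Q : Set (E n)) (κ : ℝ) :
    ∫⁻ y in Q, ENNReal.ofReal (‖φ y‖ ^ 2) ≤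
      ENNReal.ofReal 2 * (∫⁻ y in Q, ENNReal.ofReal ((‖φ y‖ - κ) ^ 2)) +
        ENNReal.ofReal (2 * κ ^ 2) * volume Q := by
  have hm : Measurable fun y => ENNReal.ofReal ((‖φ y‖ - κ) ^ 2) :=
    (ENNReal.continuous_ofReal.comp (by fun_prop)).measurable
  calc ∫⁻ y in Q, ENNReal.ofReal (‖φ y‖ ^ 2)
      ≤ ∫⁻ y in Q, (ENNReal.ofReal 2 * ENNReal.ofReal ((‖φ y‖ - κ) ^ 2) +
        ENNReal.ofReal (2 * κ ^ 2)) := by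
        refine lintegral_mono fun y => ?_
        rw [← ENNReal.ofReal_mul (by norm_num), ← ENNReal.ofReal_add (by positivity) (by positivity)]
        refine ENNReal.ofReal_le_ofReal ?_
        nlinarith [sq_nonneg (‖φ y‖ - 2 * κ)]
    _ = _ := by
        rw [lintegral_add_left (hm.const_mul _), lintegral_const_mul' _ _ ENNReal.ofReal_ne_top,
          lintegral_const, Measure.restrict_apply_univ]

/-- The sublevel set is itself an admissible `F`: it contains `Q_d \ Ω` because `φ` vanishes there,
and `|φ|² > κ²/16` off it. -/
theorem molchanov_le_of_level {Ω : Set (E n)} {V : E n → ℝ} (a : E n → E n) {φ : E n → ℂ}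
    {c d κ : ℝ} {x : E n} (hφ : IsTest Ω φ) (hκ : 0 < κ)
    (hcap : cap x d {y | y ∈ cube x d ∧ ‖φ y‖ ≤ κ / 4} ≤ ENNReal.ofReal c * cap x d (cube x d)) :
    molchanov Ω c x d V ≤ ENNReal.ofReal (16 / κ ^ 2) * energy (cube x d) a V φ := by
  have hcl : IsClosed {y | y ∈ cube x d ∧ ‖φ y‖ ≤ κ / 4} :=
    (isClosed_cube x d).inter (isClosed_le hφ.continuous.norm continuous_const)
  have hsub : cube x d ∩ Ωᶜ ⊆ {y | y ∈ cube x d ∧ ‖φ y‖ ≤ κ / 4} := by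
    rintro y ⟨hy, hy'⟩
    refine ⟨hy, ?_⟩
    rw [hφ.eq_zero_of_notMem hy', norm_zero]
    positivity
  refine (iInf₂_le {y | y ∈ cube x d ∧ ‖φ y‖ ≤ κ / 4} ⟨hcl, fun y hy => hy.1, hsub, hcap⟩).trans ?_
  · have hm : MeasurableSet (cube x d \ {y | y ∈ cube x d ∧ ‖φ y‖ ≤ κ / 4}) :=
      (measurableSet_cube x d).diff hcl.measurableSet
    calc _ ≤ ∫⁻ y in cube x d \ {y | y ∈ cube x d ∧ ‖φ y‖ ≤ κ / 4},
          ENNReal.ofReal (16 / κ ^ 2) * ENNReal.ofReal (V y * ‖φ y‖ ^ 2) := by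
          refine setLIntegral_mono' hm fun y hy => ?_
          rw [← ENNReal.ofReal_mul (by positivity)]
          rcases le_total (V y) 0 with h | h
          · rw [ENNReal.ofReal_of_nonpos h]; exact zero_le
          · refine ENNReal.ofReal_le_ofReal ?_
            have h1 : κ / 4 < ‖φ y‖ := by
              by_contra h'
              exact hy.2 ⟨hy.1, not_lt.1 h'⟩
            have h2 : κ ^ 2 / 16 ≤ ‖φ y‖ ^ 2 := by
              have : (κ / 4) ^ 2 ≤ ‖φ y‖ ^ 2 := by gcongr
              linarith [this, (by ring : (κ / 4) ^ 2 = κ ^ 2 / 16)]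
            calc V y = 16 / κ ^ 2 * (V y * (κ ^ 2 / 16)) := by field_simp
              _ ≤ _ := by gcongr
      _ ≤ ENNReal.ofReal (16 / κ ^ 2) *
            ∫⁻ y in cube x d, ENNReal.ofReal (V y * ‖φ y‖ ^ 2) := by
          rw [lintegral_const_mul' _ _ ENNReal.ofReal_ne_top]
          gcongr
          exact Set.sdiff_subset
      _ ≤ _ := by
          gcongr
          exact lintegral_mul_le_energy _ _ _ _

/-- If the energy on `Q_{2d}` were too small, `|φ|` would be nearly a constant `κ`, its low sublevel
set negligible in capacity, and `V` too small in integral off that set. The constant `δ` is uniform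
in the domain, the potentials, the function and the centre. -/
theorem lintegral_sq_le_energy_of_le_molchanov (hn : 2 ≤ n) {c d m : ℝ} (hc : 0 < c) (hd : 0 < d)
    (hm : 0 < m) : ∃ δ : ℝ, 0 < δ ∧ ∀ (Ω : Set (E n)) (a : E n → E n) (V : E n → ℝ) (φ : E n → ℂ)
      (x : E n), FormData Ω a V → IsTest Ω φ → ENNReal.ofReal m ≤ molchanov Ω c x d V →
      ENNReal.ofReal δ * ∫⁻ y in cube x (2 * d), ENNReal.ofReal (‖φ y‖ ^ 2) ≤
        energy (cube x (2 * d)) a V φ := by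
  obtain ⟨C, hC, hsub⟩ := cap_sublevel_le n
  obtain ⟨c₀, hc₀, hcap⟩ := le_cap_cube hn
  have hn0 : (0 : ℝ) < n := by exact_mod_cast (by omega : 0 < n)
  set p : ℝ := n * 2 ^ n with hp
  have hp0 : 0 < p := by positivity
  -- The first bound absorbs the Poincaré error into half of the mass, forcing `N ≤ 4κ²(2d)^n`. The
  -- second makes the sublevel set admissible for `c`. The third makes `16 h/κ²` smaller than `m`.
  set δ : ℝ := min (1 / (16 * p * d ^ 2)) (min (c * c₀ / (C * (4 * p + 1) * (4 * 2 ^ n * d ^ 2)))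
    (m / (64 * (2 * d) ^ n))) with hδ
  have hδ1 : δ ≤ 1 / (16 * p * d ^ 2) := min_le_left _ _
  have hδ2 : δ ≤ c * c₀ / (C * (4 * p + 1) * (4 * 2 ^ n * d ^ 2)) :=
    (min_le_right _ _).trans (min_le_left _ _)
  have hδ3 : δ ≤ m / (64 * (2 * d) ^ n) := (min_le_right _ _).trans (min_le_right _ _)
  have hδ0 : 0 < δ := by positivity
  rw [le_div_iff₀ (by positivity)] at hδ1 hδ2 hδ3
  refine ⟨δ, hδ0, fun Ω a V φ x P hφ hmol => ?_⟩
  by_contra! hlt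
  set Q' := cube x (2 * d) with hQ'
  obtain ⟨N, hN0, hN⟩ : ∃ N : ℝ, 0 ≤ N ∧ ∫⁻ y in Q', ENNReal.ofReal (‖φ y‖ ^ 2) = ENNReal.ofReal N :=
    ⟨_, ENNReal.toReal_nonneg, (ENNReal.ofReal_toReal (hφ.lintegral_sq_ne_top _)).symm⟩
  obtain ⟨h, hh0, hh⟩ : ∃ h : ℝ, 0 ≤ h ∧ energy Q' a V φ = ENNReal.ofReal h :=
    ⟨_, ENNReal.toReal_nonneg, (ENNReal.ofReal_toReal hlt.ne_top).symm⟩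
  rw [hh, hN, ← ENNReal.ofReal_mul hδ0.le, ENNReal.ofReal_lt_ofReal_iff_of_nonneg hh0] at hlt
  have hNpos : 0 < N := by
    by_contra h'
    nlinarith [not_lt.1 h']
  have hE0 : energy Q' a (fun _ => 0) φ ≤ ENNReal.ofReal h :=
    hh ▸ P.energy_zero_le (fun y hy => hφ.eq_zero_of_notMem hy) Q'
  obtain ⟨κ, hκ0, hκ⟩ := exists_sq_norm_sub_le_energy a (hφ.smooth.of_le (by simp)) x
    (d := 2 * d) (by positivity)
  have hI : ∫⁻ y in Q', ENNReal.ofReal ((‖φ y‖ - κ) ^ 2) ≤ ENNReal.ofReal (4 * p * d ^ 2 * h) := by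
    refine hκ.trans ?_
    rw [show 4 * p * d ^ 2 * h = (n * 2 ^ n * (2 * d) ^ 2) * h by rw [hp]; ring,
      ENNReal.ofReal_mul (p := n * 2 ^ n * (2 * d) ^ 2) (by positivity)]
    exact mul_le_mul_right hE0 _
  have hNle : N ≤ 2 * (4 * p * d ^ 2 * h) + 2 * κ ^ 2 * (2 * d) ^ n := by
    rw [← ENNReal.ofReal_le_ofReal_iff (by positivity), ← hN]
    calc ∫⁻ y in Q', ENNReal.ofReal (‖φ y‖ ^ 2)
        ≤ ENNReal.ofReal 2 * (∫⁻ y in Q', ENNReal.ofReal ((‖φ y‖ - κ) ^ 2)) +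
          ENNReal.ofReal (2 * κ ^ 2) * volume Q' := lintegral_sq_norm_le hφ.continuous _ _
      _ ≤ ENNReal.ofReal 2 * ENNReal.ofReal (4 * p * d ^ 2 * h) +
          ENNReal.ofReal (2 * κ ^ 2) * ENNReal.ofReal ((2 * d) ^ n) := by
          rw [hQ', volume_cube x (by positivity)]
          gcongr
      _ = _ := by
          rw [← ENNReal.ofReal_mul (by norm_num), ← ENNReal.ofReal_mul (by positivity),
            ← ENNReal.ofReal_add (by positivity) (by positivity)]
  have hκN : N ≤ 4 * κ ^ 2 * (2 * d) ^ n := by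
    have h1 : 2 * (4 * p * d ^ 2 * h) ≤ 2 * (4 * p * d ^ 2 * (δ * N)) := by gcongr
    have h2 : δ * (16 * p * d ^ 2) * N ≤ 1 * N := by gcongr
    nlinarith
  have hκpos : 0 < κ := by
    refine hκ0.lt_of_ne fun h0 => ?_
    rw [← h0] at hκN
    simp at hκN
    linarith
  have hhκ : h / κ ^ 2 < δ * (4 * (2 * d) ^ n) := by
    rw [div_lt_iff₀ (by positivity)]
    calc h < δ * N := hlt
      _ ≤ δ * (4 * κ ^ 2 * (2 * d) ^ n) := by gcongr
      _ = _ := by ring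
  have hcapF : cap x d {y | y ∈ cube x d ∧ ‖φ y‖ ≤ κ / 4} ≤
      ENNReal.ofReal c * cap x d (cube x d) := by
    refine (hsub a φ x d κ (4 * p * d ^ 2 * h) h hφ.smooth hd hκpos (by positivity) hh0 hI hE0).trans ?_
    refine le_trans ?_ (mul_le_mul_right (hcap x d hd) _)
    rw [← ENNReal.ofReal_mul hc.le]
    refine ENNReal.ofReal_le_ofReal ?_
    calc C * (4 * p * d ^ 2 * h / d ^ 2 + h) / κ ^ 2 = C * (4 * p + 1) * (h / κ ^ 2) := by
          field_simp
      _ ≤ C * (4 * p + 1) * (δ * (4 * (2 * d) ^ n)) := by gcongr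
      _ = (δ * (C * (4 * p + 1) * (4 * 2 ^ n * d ^ 2))) * (d ^ n / d ^ 2) := by
          rw [mul_pow]; field_simp
      _ ≤ (c * c₀) * (d ^ n / d ^ 2) := by gcongr
      _ = _ := by ring
  have hfin := hmol.trans (molchanov_le_of_level a hφ hκpos hcapF)
  have hfin2 : ENNReal.ofReal m ≤ ENNReal.ofReal (16 / κ ^ 2 * h) := by
    refine hfin.trans ?_
    rw [ENNReal.ofReal_mul (by positivity), ← hh]
    gcongr
    exact energy_mono _ _ _ (cube_subset_cube x (by linarith))
  rw [ENNReal.ofReal_le_ofReal_iff (by positivity)] at hfin2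
  have : 16 / κ ^ 2 * h = 16 * (h / κ ^ 2) := by ring
  rw [this] at hfin2
  nlinarith

theorem lintegral_sq_le_energy_of_le_localEnergy {Ω : Set (E n)} {a : E n → E n} {φ : E n → ℂ}
    {x : E n} {d : ℝ} (hφ : IsTest Ω φ) :
    localEnergy Ω x d a * ∫⁻ y in cube x d, ENNReal.ofReal (‖φ y‖ ^ 2) ≤
      energy (cube x d) a (fun _ => 0) φ := by
  by_cases h : ∃ y ∈ cube x d, φ y ≠ 0
  · refine ENNReal.mul_le_of_le_div (iInf₂_le φ ⟨hφ.smooth, h, ?_⟩)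
    have h1 : (tsupport φ)ᶜ ∈ 𝓝ˢ (cube x d ∩ Ωᶜ) :=
      (isClosed_tsupport φ).isOpen_compl.mem_nhdsSet.2
        fun y hy h' => hy.2 (hφ.support_subset h')
    filter_upwards [h1] with y hy
    exact image_eq_zero_of_notMem_tsupport hy
  · push Not at h
    have : ∫⁻ y in cube x d, ENNReal.ofReal (‖φ y‖ ^ 2) = 0 := by
      rw [setLIntegral_congr_fun (measurableSet_cube x d) (g := fun _ => 0) fun y hy => by
        simp [h y hy]]
      simp
    rw [this, mul_zero]
    exact zero_le

theorem lintegral_sq_le_energy_of_le_criterion (hn : 2 ≤ n) {c d d₁ : ℝ} (hc : 0 < c) (hd : 0 < d)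
    (hd₁ : 0 < d₁) : ∃ δ : ℝ, 0 < δ ∧ ∀ (Ω : Set (E n)) (a : E n → E n) (V : E n → ℝ)
      (φ : E n → ℂ) (x : E n), FormData Ω a V → IsTest Ω φ →
      ENNReal.ofReal (1 / d₁ ^ 2) ≤ criterion Ω a V c d x →
      ENNReal.ofReal δ * ∫⁻ y in cube x d, ENNReal.ofReal (‖φ y‖ ^ 2) ≤
        energy (cube x (2 * d)) a V φ := by
  obtain ⟨δ, hδ, H⟩ := lintegral_sq_le_energy_of_le_molchanov hn (m := d ^ n * (1 / (2 * d₁ ^ 2)))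
    hc hd (by positivity)
  refine ⟨min δ (1 / (2 * d₁ ^ 2)), by positivity, fun Ω a V φ x P hφ hcr => ?_⟩
  have hsub : cube x d ⊆ cube x (2 * d) := cube_subset_cube x (by linarith)
  -- One of the two terms of the criterion is at least half of the lower bound.
  rcases le_total (ENNReal.ofReal (1 / (2 * d₁ ^ 2))) (localEnergy Ω x d a) with h | h
  · calc _ ≤ localEnergy Ω x d a * ∫⁻ y in cube x d, ENNReal.ofReal (‖φ y‖ ^ 2) := by
          gcongr
          exact (ENNReal.ofReal_le_ofReal (min_le_right _ _)).trans h
      _ ≤ _ := lintegral_sq_le_energy_of_le_localEnergy hφ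
      _ ≤ _ := P.energy_zero_le (fun y hy => hφ.eq_zero_of_notMem hy) _
      _ ≤ _ := energy_mono _ _ _ hsub
  · have h1 : ENNReal.ofReal (1 / (2 * d₁ ^ 2)) ≤
        ENNReal.ofReal ((d ^ n)⁻¹) * molchanov Ω c x d V := by
      have h2 : ENNReal.ofReal (1 / d₁ ^ 2) =
          ENNReal.ofReal (1 / (2 * d₁ ^ 2)) + ENNReal.ofReal (1 / (2 * d₁ ^ 2)) := by
        rw [← ENNReal.ofReal_add (by positivity) (by positivity)]
        congr 1
        field_simp; norm_num
      rw [h2, criterion] at hcr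
      exact (ENNReal.add_le_add_iff_left ENNReal.ofReal_ne_top).1
        (hcr.trans (add_le_add_left h _))
    have h3 : ENNReal.ofReal (d ^ n * (1 / (2 * d₁ ^ 2))) ≤ molchanov Ω c x d V := by
      rw [ENNReal.ofReal_mul (by positivity)]
      calc _ ≤ ENNReal.ofReal (d ^ n) * (ENNReal.ofReal ((d ^ n)⁻¹) * molchanov Ω c x d V) := by
            gcongr
        _ = _ := by
            rw [← mul_assoc, ← ENNReal.ofReal_mul (by positivity),
              mul_inv_cancel₀ (by positivity), ENNReal.ofReal_one, one_mul]
    refine le_trans ?_ (H Ω a V φ x P hφ h3)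
    gcongr
    exact min_le_left _ _

theorem FormData.aemeasurable_energy {Ω : Set (E n)} {a : E n → E n} {V : E n → ℝ} {φ : E n → ℂ}
    (P : FormData Ω a V) (hφ : IsTest Ω φ) :
    AEMeasurable fun y => ENNReal.ofReal ((∑ j, ‖magD a φ j y‖ ^ 2) + V y * ‖φ y‖ ^ 2) := by
  have h1 : AEMeasurable fun y => ENNReal.ofReal ((∑ j, ‖magD a φ j y‖ ^ 2) +
      ‖(Real.sqrt (V y) : ℂ) * φ y‖ ^ 2) :=
    ((Finset.aemeasurable_fun_sum _ fun j _ => (P.memLp_magD hφ j).1.norm.aemeasurable.pow_const 2).add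
      ((P.memLp_sqrt hφ).1.norm.aemeasurable.pow_const 2)).ennreal_ofReal
  refine h1.congr ?_
  filter_upwards [(ae_restrict_iff' P.isOpen.measurableSet).1 P.nonneg] with y hy
  by_cases h : y ∈ Ω
  · rw [norm_mul, mul_pow, Complex.norm_real, Real.norm_eq_abs, sq_abs, Real.sq_sqrt (hy h)]
  · simp [hφ.eq_zero_of_notMem h]

theorem energy_univ_eq {Ω : Set (E n)} (hΩ : IsOpen Ω) (a : E n → E n) (V : E n → ℝ) {φ : E n → ℂ}
    (hφ : IsTest Ω φ) : ∫⁻ y, ENNReal.ofReal ((∑ j, ‖magD a φ j y‖ ^ 2) + V y * ‖φ y‖ ^ 2) =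
      energy Ω a V φ := by
  rw [energy, ← lintegral_indicator hΩ.measurableSet]
  refine lintegral_congr fun y => ?_
  by_cases h : y ∈ Ω
  · rw [Set.indicator_of_mem h]
  · have h' : y ∉ tsupport φ := fun h' => h (hφ.support_subset h')
    rw [Set.indicator_of_notMem h]
    simp [magD_eq_zero_of_notMem_tsupport a h', hφ.eq_zero_of_notMem h]

theorem strictlyPositive_of_criterion (hn : 2 ≤ n) {Ω : Set (E n)} {a : E n → E n} {V : E n → ℝ}
    (P : FormData Ω a V) {c d d₁ : ℝ} (hc : 0 < c) (hd : 0 < d) (hd₁ : 0 < d₁)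
    (H : ∀ x, ENNReal.ofReal (1 / d₁ ^ 2) ≤ criterion Ω a V c d x) : StrictlyPositive Ω a V := by
  obtain ⟨δ, hδ, hcube⟩ := lintegral_sq_le_energy_of_le_criterion hn hc hd hd₁
  -- Averaging weighs the mass on `Q_d` by `d^n` and the energy on `Q_{2d}` by `(2d)^n`; their ratio
  -- is the loss `2 ^ n`.
  refine P.strictlyPositive_iff.2 ⟨δ / 2 ^ n, by positivity, fun φ hφ => ?_⟩
  have hdn : ENNReal.ofReal (d ^ n) ≠ 0 := by simpa using pow_pos hd n
  refine (ENNReal.mul_le_mul_iff_right (a := ENNReal.ofReal ((2 * d) ^ n))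
    (by simpa using by positivity) ENNReal.ofReal_ne_top).1 ?_
  have hφm : AEMeasurable fun y => ENNReal.ofReal (‖φ y‖ ^ 2) := by
    have := hφ.continuous
    exact (ENNReal.continuous_ofReal.comp (by fun_prop)).measurable.aemeasurable
  calc ENNReal.ofReal ((2 * d) ^ n) *
        (ENNReal.ofReal (δ / 2 ^ n) * ∫⁻ y in Ω, ENNReal.ofReal (‖φ y‖ ^ 2))
      ≤ ENNReal.ofReal ((2 * d) ^ n) *
        (ENNReal.ofReal (δ / 2 ^ n) * ∫⁻ y, ENNReal.ofReal (‖φ y‖ ^ 2)) := by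
        gcongr
        exact Measure.restrict_le_self
    _ = ENNReal.ofReal δ * (ENNReal.ofReal (d ^ n) * ∫⁻ y, ENNReal.ofReal (‖φ y‖ ^ 2)) := by
        rw [← mul_assoc, ← mul_assoc, ← ENNReal.ofReal_mul (by positivity),
          ← ENNReal.ofReal_mul (by positivity)]
        congr 2
        rw [mul_pow]; field_simp
    _ = ∫⁻ x, ENNReal.ofReal δ * ∫⁻ y in cube x d, ENNReal.ofReal (‖φ y‖ ^ 2) := by
        rw [lintegral_const_mul' _ _ ENNReal.ofReal_ne_top, lintegral_lintegral_cube hφm hd.le]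
    _ ≤ ∫⁻ x, energy (cube x (2 * d)) a V φ := lintegral_mono fun x => hcube Ω a V φ x P hφ (H x)
    _ = _ := by
        unfold energy
        rw [lintegral_lintegral_cube (P.aemeasurable_energy hφ) (by positivity),
          energy_univ_eq P.isOpen a V hφ]
        rfl

/-! ### From strict positivity to the criterion on large cubes -/

theorem magD_ofReal_mul (a : E n → E n) {θ : E n → ℝ} {u : E n → ℂ} (hθ : Differentiable ℝ θ)
    (hu : Differentiable ℝ u) (j : Fin n) (y : E n) :
    magD a (fun z => (θ z : ℂ) * u z) j y =
      (θ y : ℂ) * magD a u j y + (fderiv ℝ θ y (EuclideanSpace.single j 1) : ℝ) * u y := by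
  have hθ' : Differentiable ℝ fun z => (θ z : ℂ) := Complex.ofRealCLM.differentiable.comp hθ
  have h : partialD (fun z => (θ z : ℂ) * u z) j y =
      (θ y : ℂ) * partialD u j y + partialD (fun z => (θ z : ℂ)) j y * u y := by
    simp only [partialD]
    rw [fderiv_fun_mul (hθ' y) (hu y)]
    simp only [add_apply, smul_apply, smul_eq_mul]
    ring
  rw [magD, h, partialD_ofReal hθ, magD]
  ring

/-- The smooth truncation `u / √(|u|² + s²)`. -/
def truncate (u : E n → ℂ) (s : ℝ) (y : E n) : ℂ := (((regNorm u s y)⁻¹ : ℝ) : ℂ) * u y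

section truncate

variable {u : E n → ℂ} {s : ℝ}

theorem regNorm_pos (hs : 0 < s) (y : E n) : 0 < regNorm u s y := Real.sqrt_pos.2 (by positivity)

theorem regNorm_sq (u : E n → ℂ) (s : ℝ) (y : E n) : regNorm u s y ^ 2 = ‖u y‖ ^ 2 + s ^ 2 :=
  Real.sq_sqrt (by positivity)

theorem norm_le_regNorm (u : E n → ℂ) (s : ℝ) (y : E n) : ‖u y‖ ≤ regNorm u s y :=
  Real.le_sqrt_of_sq_le (by nlinarith [sq_nonneg s])

theorem le_regNorm (u : E n → ℂ) (s : ℝ) (y : E n) : s ≤ regNorm u s y :=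
  Real.le_sqrt_of_sq_le (by nlinarith [sq_nonneg ‖u y‖])

theorem norm_truncate_sq (y : E n) :
    ‖truncate u s y‖ ^ 2 = ‖u y‖ ^ 2 / (‖u y‖ ^ 2 + s ^ 2) := by
  rw [truncate, norm_mul, mul_pow, Complex.norm_real, Real.norm_eq_abs, sq_abs, inv_pow, regNorm_sq,
    div_eq_inv_mul]

theorem norm_truncate_le_one (hs : 0 < s) (y : E n) : ‖truncate u s y‖ ≤ 1 := by
  rw [← sq_le_one_iff₀ (norm_nonneg _), norm_truncate_sq, div_le_one (by positivity)]
  nlinarith [sq_nonneg s]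

theorem contDiff_truncate (hu : ContDiff ℝ ∞ u) (hs : 0 < s) : ContDiff ℝ ∞ (truncate u s) :=
  (Complex.ofRealCLM.contDiff.comp
    ((contDiff_regNorm hu hs).inv fun y => (regNorm_pos hs y).ne')).mul hu

/-- Product rule with Kato's inequality for the regularised modulus `R`: each of the two terms is at
most `|(∇ₐu)ⱼ|/R`, and `R ≥ s`. The phase of `u` is kept, so only the magnetic derivative appears.
-/
theorem norm_magD_truncate_le (a : E n → E n) (hu : ContDiff ℝ ∞ u) (hs : 0 < s) (j : Fin n)
    (y : E n) : ‖magD a (truncate u s) j y‖ ≤ 2 / s * ‖magD a u j y‖ := by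
  have hr : Differentiable ℝ (regNorm u s) := (contDiff_regNorm hu hs).differentiable (by simp)
  have hpos := regNorm_pos (u := u) hs
  have hd : HasFDerivAt (fun z => (regNorm u s z)⁻¹)
      (-(regNorm u s y ^ 2)⁻¹ • fderiv ℝ (regNorm u s) y) y := by
    exact (hasDerivAt_inv (hpos y).ne').comp_hasFDerivAt y (hr y).hasFDerivAt
  have h := magD_ofReal_mul a (θ := fun z => (regNorm u s z)⁻¹)
    (fun z => (hr z).inv (hpos z).ne') (hu.differentiable (by simp)) j y
  rw [show truncate u s = fun z => (((regNorm u s z)⁻¹ : ℝ) : ℂ) * u z from rfl, h, hd.fderiv]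
  have hk := norm_fderiv_regNorm_apply_le a (hu.of_le (by simp)) hs y j
  have hle := norm_le_regNorm u s y
  have hsr := le_regNorm u s y
  have hy := hpos y
  set R := regNorm u s y
  calc _ ≤ R⁻¹ * ‖magD a u j y‖ + (R ^ 2)⁻¹ * ‖magD a u j y‖ * R := by
        refine (norm_add_le _ _).trans (add_le_add (le_of_eq ?_) ?_)
        · rw [norm_mul, Complex.norm_real, norm_inv, Real.norm_of_nonneg hy.le]
        · rw [norm_mul, Complex.norm_real, smul_apply, smul_eq_mul, norm_mul, norm_neg, norm_inv,
            norm_pow, Real.norm_of_nonneg hy.le]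
          gcongr
    _ = 2 / R * ‖magD a u j y‖ := by field_simp; norm_num
    _ ≤ _ := by gcongr

end truncate

/-- A lower bound for the mass of `(1 - g) u / √(|u|² + s²)` when `|u|` is close to `κ` and `g` is
small in the mean. -/
theorem volume_le_lintegral_truncate {Q : Set (E n)} (hQ : MeasurableSet Q) {u φ : E n → ℂ}
    {g : E n → ℝ} {s κ : ℝ} (hu : Continuous u) (hg : Continuous g) (hs : 0 < s) (hκ : s / 2 ≤ κ)
    (hφ : ∀ y ∈ Q, φ y = ((1 - g y : ℝ) : ℂ) * truncate u s y) :
    volume Q ≤ ENNReal.ofReal 68 * (∫⁻ y in Q, ENNReal.ofReal (‖φ y‖ ^ 2)) +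
      (ENNReal.ofReal (4 / κ ^ 2) * (∫⁻ y in Q, ENNReal.ofReal ((‖u y‖ - κ) ^ 2)) +
        ENNReal.ofReal 4 * ∫⁻ y in Q, ENNReal.ofReal (‖g y‖ ^ 2)) := by
  have hκ0 : 0 < κ := by linarith
  have m1 : Measurable fun y => ENNReal.ofReal ((‖u y‖ - κ) ^ 2) :=
    (ENNReal.continuous_ofReal.comp (by fun_prop)).measurable
  have m2 : Measurable fun y => ENNReal.ofReal (‖g y‖ ^ 2) :=
    (ENNReal.continuous_ofReal.comp (by fun_prop)).measurable
  have m3 : Measurable fun y => ENNReal.ofReal (4 / κ ^ 2) * ENNReal.ofReal ((‖u y‖ - κ) ^ 2) +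
      ENNReal.ofReal 4 * ENNReal.ofReal (‖g y‖ ^ 2) := (m1.const_mul _).add (m2.const_mul _)
  rw [← lintegral_const_mul' _ _ ENNReal.ofReal_ne_top, ← lintegral_const_mul' _ _ ENNReal.ofReal_ne_top,
    ← lintegral_const_mul' _ _ ENNReal.ofReal_ne_top, ← lintegral_add_left (m1.const_mul _),
    ← lintegral_add_right _ m3, ← setLIntegral_one]
  refine setLIntegral_mono' hQ fun y hy => ?_
  rw [← ENNReal.ofReal_mul (by norm_num), ← ENNReal.ofReal_mul (by positivity),
    ← ENNReal.ofReal_mul (by norm_num), ← ENNReal.ofReal_add (by positivity) (by positivity),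
    ← ENNReal.ofReal_add (by positivity) (by positivity), ← ENNReal.ofReal_one]
  refine ENNReal.ofReal_le_ofReal ?_
  have n1 : 0 ≤ 4 / κ ^ 2 * (‖u y‖ - κ) ^ 2 := by positivity
  have n2 : 0 ≤ 4 * ‖g y‖ ^ 2 := by positivity
  have n3 : 0 ≤ 68 * ‖φ y‖ ^ 2 := by positivity
  -- At each point one of the three terms is at least 1: `|u|` is far from `κ`, or `g > 1/2`, or
  -- neither. In the last case `|u| ≥ κ/2 ≥ s/4` makes the squared truncation at least 1/17 and
  -- `(1-g)² ≥ 1/4`, whence `68 = 4 · 17`.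
  rcases lt_or_ge ‖u y‖ (κ / 2) with h | h
  · have : 1 ≤ 4 / κ ^ 2 * (‖u y‖ - κ) ^ 2 := by
      rw [div_mul_eq_mul_div, one_le_div (by positivity)]
      nlinarith
    linarith
  rcases lt_or_ge (1 / 2) (g y) with h' | h'
  · rw [Real.norm_eq_abs, sq_abs] at *
    nlinarith
  · have e1 : (1 / 17 : ℝ) ≤ ‖truncate u s y‖ ^ 2 := by
      rw [norm_truncate_sq, le_div_iff₀ (by positivity)]
      have : (s / 4) ^ 2 ≤ ‖u y‖ ^ 2 := by gcongr; linarith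
      nlinarith
    have e2 : (1 / 4 : ℝ) ≤ (1 - g y) ^ 2 := by nlinarith
    have e3 : (1 / 4 : ℝ) * (1 / 17) ≤ ‖φ y‖ ^ 2 := by
      rw [hφ y hy, norm_mul, mul_pow, Complex.norm_real, Real.norm_eq_abs, sq_abs]
      gcongr
    linarith

/-- An upper bound for the magnetic energy of `χ (1 - g) u / √(|u|² + s²)`. -/
theorem energy_cutoff_truncate_le (a : E n → E n) {Q : Set (E n)} {u : E n → ℂ}
    {χ g : E n → ℝ} {s C : ℝ} (hu : ContDiff ℝ ∞ u) (hχ : ContDiff ℝ ∞ χ) (hg : ContDiff ℝ ∞ g)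
    (hs : 0 < s) (hχ0 : ∀ y, 0 ≤ χ y) (hχ1 : ∀ y, χ y ≤ 1) (hg0 : ∀ y, 0 ≤ g y)
    (hg1 : ∀ y, g y ≤ 1) (hC : ∀ y, ‖fderiv ℝ χ y‖ ≤ C) :
    energy Q a (fun _ => 0) (fun y => ((χ y * (1 - g y) : ℝ) : ℂ) * truncate u s y) ≤
      ENNReal.ofReal (4 * n * C ^ 2) * volume Q + ENNReal.ofReal 4 * dirichlet g +
        ENNReal.ofReal (8 / s ^ 2) * energy Q a (fun _ => 0) u := by
  have hθ : ContDiff ℝ ∞ (fun y => χ y * (1 - g y)) := hχ.mul (contDiff_const.sub hg)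
  have hpt : ∀ y, ENNReal.ofReal ((∑ j, ‖magD a (fun y => ((χ y * (1 - g y) : ℝ) : ℂ) *
      truncate u s y) j y‖ ^ 2) + 0 * ‖((χ y * (1 - g y) : ℝ) : ℂ) * truncate u s y‖ ^ 2) ≤
      (ENNReal.ofReal (4 * n * C ^ 2) + ENNReal.ofReal 4 *
        ENNReal.ofReal (∑ j, ‖fderiv ℝ g y (EuclideanSpace.single j 1)‖ ^ 2)) +
      ENNReal.ofReal (8 / s ^ 2) *
        ENNReal.ofReal ((∑ j, ‖magD a u j y‖ ^ 2) + 0 * ‖u y‖ ^ 2) := by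
    intro y
    rw [zero_mul, add_zero, zero_mul, add_zero, ← ENNReal.ofReal_mul (by norm_num),
      ← ENNReal.ofReal_mul (by positivity),
      ← ENNReal.ofReal_add (by positivity) (by positivity),
      ← ENNReal.ofReal_add (by positivity) (by positivity)]
    refine ENNReal.ofReal_le_ofReal ?_
    have hj : ∀ j, ‖magD a (fun y => ((χ y * (1 - g y) : ℝ) : ℂ) * truncate u s y) j y‖ ^ 2 ≤
        4 * C ^ 2 + 4 * ‖fderiv ℝ g y (EuclideanSpace.single j 1)‖ ^ 2 +
          8 / s ^ 2 * ‖magD a u j y‖ ^ 2 := by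
      intro j
      rw [magD_ofReal_mul a (hθ.differentiable (by simp))
        ((contDiff_truncate hu hs).differentiable (by simp))]
      have hT := norm_truncate_le_one (u := u) hs y
      have hm := norm_magD_truncate_le a hu hs j y
      have hχg : |χ y * (1 - g y)| ≤ 1 := by
        rw [abs_of_nonneg (mul_nonneg (hχ0 y) (by linarith [hg1 y]))]
        exact mul_le_one₀ (hχ1 y) (by linarith [hg1 y]) (by linarith [hg0 y])
      have hfd : fderiv ℝ (fun y => χ y * (1 - g y)) y (EuclideanSpace.single j 1) =
          (1 - g y) * fderiv ℝ χ y (EuclideanSpace.single j 1)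
            - χ y * fderiv ℝ g y (EuclideanSpace.single j 1) := by
        rw [fderiv_fun_mul (hχ.differentiable (by simp)).differentiableAt
          ((contDiff_const.sub hg).differentiable (by simp)).differentiableAt, fderiv_const_sub]
        simp only [add_apply, smul_apply, smul_eq_mul, neg_apply]
        ring
      rw [hfd]
      have hcj : |fderiv ℝ χ y (EuclideanSpace.single j 1)| ≤ C := by
        refine ((fderiv ℝ χ y).le_opNorm _).trans ?_
        simpa using hC y
      set p := fderiv ℝ χ y (EuclideanSpace.single j 1)
      set q := fderiv ℝ g y (EuclideanSpace.single j 1)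
      set t := χ y * (1 - g y)
      have hpq : ((1 - g y) * p - χ y * q) ^ 2 ≤ 2 * C ^ 2 + 2 * ‖q‖ ^ 2 := by
        have k1 : (1 - g y) ^ 2 ≤ 1 := by nlinarith [hg0 y, hg1 y]
        have k2 : χ y ^ 2 ≤ 1 := pow_le_one₀ (hχ0 y) (hχ1 y)
        have k3 : p ^ 2 ≤ C ^ 2 := by rw [← sq_abs]; gcongr
        rw [Real.norm_eq_abs, sq_abs]
        calc ((1 - g y) * p - χ y * q) ^ 2
            ≤ 2 * ((1 - g y) ^ 2 * p ^ 2) + 2 * (χ y ^ 2 * q ^ 2) := by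
              nlinarith [sq_nonneg ((1 - g y) * p + χ y * q)]
          _ ≤ 2 * (1 * C ^ 2) + 2 * (1 * q ^ 2) := by gcongr
          _ = _ := by ring
      have hA : ‖(t : ℂ) * magD a (truncate u s) j y‖ ≤ 2 / s * ‖magD a u j y‖ := by
        rw [norm_mul, Complex.norm_real, Real.norm_eq_abs]
        calc _ ≤ 1 * (2 / s * ‖magD a u j y‖) := by gcongr
          _ = _ := one_mul _
      have hB : ‖(((1 - g y) * p - χ y * q : ℝ) : ℂ) * truncate u s y‖ ^ 2 ≤
          2 * C ^ 2 + 2 * ‖q‖ ^ 2 := by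
        rw [norm_mul, mul_pow, Complex.norm_real, Real.norm_eq_abs, sq_abs]
        calc _ ≤ (2 * C ^ 2 + 2 * ‖q‖ ^ 2) * 1 := by
              gcongr
              exact pow_le_one₀ (norm_nonneg _) hT
          _ = _ := mul_one _
      calc _ ≤ (‖(t : ℂ) * magD a (truncate u s) j y‖ +
              ‖(((1 - g y) * p - χ y * q : ℝ) : ℂ) * truncate u s y‖) ^ 2 := by
            gcongr; exact norm_add_le _ _
        _ ≤ 2 * ‖(t : ℂ) * magD a (truncate u s) j y‖ ^ 2 +
              2 * ‖(((1 - g y) * p - χ y * q : ℝ) : ℂ) * truncate u s y‖ ^ 2 := by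
            rw [← mul_add]; exact add_sq_le
        _ ≤ 2 * (2 / s * ‖magD a u j y‖) ^ 2 + 2 * (2 * C ^ 2 + 2 * ‖q‖ ^ 2) := by gcongr
        _ = _ := by ring
    refine (Finset.sum_le_sum fun j _ => hj j).trans (le_of_eq ?_)
    rw [Finset.sum_add_distrib, Finset.sum_add_distrib, Finset.sum_const, Finset.card_univ,
      Fintype.card_fin, nsmul_eq_mul, Finset.mul_sum, Finset.mul_sum]
    ring
  have hm : Measurable fun y =>
      ENNReal.ofReal (∑ j, ‖fderiv ℝ g y (EuclideanSpace.single j 1)‖ ^ 2) :=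
    (Finset.measurable_fun_sum _ fun j _ =>
      ((measurable_fderiv_apply_const ℝ g _).norm.pow_const 2)).ennreal_ofReal
  have hm' : Measurable fun y => ENNReal.ofReal (4 * n * C ^ 2) + ENNReal.ofReal 4 *
      ENNReal.ofReal (∑ j, ‖fderiv ℝ g y (EuclideanSpace.single j 1)‖ ^ 2) :=
    measurable_const.add (hm.const_mul _)
  refine (lintegral_mono hpt).trans ?_
  rw [lintegral_add_left hm', lintegral_add_left measurable_const,
    lintegral_const, Measure.restrict_apply_univ, lintegral_const_mul' _ _ ENNReal.ofReal_ne_top,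
    lintegral_const_mul' _ _ ENNReal.ofReal_ne_top]
  gcongr
  · exact setLIntegral_le_lintegral _ _
  · exact le_rfl

theorem lintegral_sq_cube_ne_zero {u : E n → ℂ} (hu : Continuous u) {x : E n} {d : ℝ} (hd : 0 < d)
    (h : ∃ y ∈ cube x d, u y ≠ 0) : ∫⁻ y in cube x d, ENNReal.ofReal (‖u y‖ ^ 2) ≠ 0 := by
  intro h0
  have hm : Measurable fun y => ENNReal.ofReal (‖u y‖ ^ 2) :=
    (ENNReal.continuous_ofReal.comp (by fun_prop)).measurable
  have hae : u =ᵐ[volume.restrict (cube x d)] fun _ => 0 := by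
    filter_upwards [(lintegral_eq_zero_iff hm).1 h0] with y hy
    have h1 : ‖u y‖ ^ 2 ≤ 0 := ENNReal.ofReal_eq_zero.1 hy
    exact norm_eq_zero.1 (pow_eq_zero_iff two_ne_zero |>.1 (le_antisymm h1 (sq_nonneg _)))
  have hint : (interior (cube x d)).Nonempty :=
    ⟨x, interior_maximal (openCube_subset_cube x d) (isOpen_openCube x d) fun i => by simpa using hd⟩
  -- The point where `u ≠ 0` may lie on the boundary of the cube, so continuity is used up to the
  -- closure of the interior.
  have hcl : cube x d ⊆ closure (interior (cube x d)) := by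
    rw [(convex_cube x d).closure_interior_eq_closure_of_nonempty_interior hint]
    exact subset_closure
  obtain ⟨y, hy, hy'⟩ := h
  exact hy' (Measure.eqOn_of_ae_eq hae hu.continuousOn continuousOn_const hcl hy)

theorem setLIntegral_sq_le_of_isTest {Ω : Set (E n)} (hΩ : IsOpen Ω) {φ : E n → ℂ}
    (hφ : IsTest Ω φ) (G : Set (E n)) :
    ∫⁻ y in G, ENNReal.ofReal (‖φ y‖ ^ 2) ≤ ∫⁻ y in Ω, ENNReal.ofReal (‖φ y‖ ^ 2) := by
  refine (setLIntegral_le_lintegral _ _).trans ?_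
  rw [← lintegral_indicator hΩ.measurableSet]
  refine lintegral_mono fun y => ?_
  by_cases h : y ∈ Ω
  · rw [Set.indicator_of_mem h]
  · simp [hφ.eq_zero_of_notMem h]

/-- Off `F` the weight `|φ|²` is at most 1. On `F` it is at most `δ²`, and there the integral of `V`
is taken only over `K`, a compact subset of `Ω`, where `V` is integrable even though its integral
over `F` may be infinite. -/
theorem FormData.energy_le_of_bounds {Ω : Set (E n)} {a : E n → E n} {V : E n → ℝ}
    (P : FormData Ω a V) {φ : E n → ℂ} (hφ : IsTest Ω φ) {Q F K : Set (E n)} {δ : ℝ}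
    (hQ : MeasurableSet Q) (hF : MeasurableSet F) (hK : IsCompact K) (hKΩ : K ⊆ Ω)
    (hφQ : tsupport φ ⊆ Q) (hφK : tsupport φ ⊆ K) (h1 : ∀ y, ‖φ y‖ ≤ 1)
    (hδ : ∀ y ∈ F, ‖φ y‖ ≤ δ) :
    energy Ω a V φ ≤ energy Q a (fun _ => 0) φ +
      ((∫⁻ y in Q \ F, ENNReal.ofReal (V y)) +
        ENNReal.ofReal (δ ^ 2) * ∫⁻ y in K, ENNReal.ofReal (V y)) := by
  have hVpt : ∀ y, ENNReal.ofReal (V y * ‖φ y‖ ^ 2) ≤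
      (Q \ F).indicator (fun y => ENNReal.ofReal (V y)) y +
        K.indicator (fun y => ENNReal.ofReal (δ ^ 2) * ENNReal.ofReal (V y)) y := by
    intro y
    rcases le_total (V y) 0 with h | h
    · rw [ENNReal.ofReal_of_nonpos (mul_nonpos_of_nonpos_of_nonneg h (sq_nonneg _))]
      exact zero_le
    by_cases h0 : y ∈ tsupport φ
    · by_cases hy : y ∈ F
      · refine le_add_of_nonneg_of_le zero_le ?_
        rw [Set.indicator_of_mem (hφK h0), ← ENNReal.ofReal_mul (sq_nonneg _), mul_comm]
        have := hδ y hy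
        gcongr
      · refine le_add_of_le_of_nonneg ?_ zero_le
        rw [Set.indicator_of_mem (show y ∈ Q \ F from ⟨hφQ h0, hy⟩)]
        exact ENNReal.ofReal_le_ofReal
          (mul_le_of_le_one_right h (pow_le_one₀ (norm_nonneg _) (h1 y)))
    · rw [image_eq_zero_of_notMem_tsupport h0]
      simp
  have hVK : AEMeasurable (fun y => ENNReal.ofReal (δ ^ 2) * ENNReal.ofReal (V y))
      (volume.restrict K) :=
    ((P.integrableOn_compact hK hKΩ).aestronglyMeasurable.aemeasurable.ennreal_ofReal).const_mul _
  have hV : ∫⁻ y in Ω, ENNReal.ofReal (V y * ‖φ y‖ ^ 2) ≤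
      (∫⁻ y in Q \ F, ENNReal.ofReal (V y)) +
        ENNReal.ofReal (δ ^ 2) * ∫⁻ y in K, ENNReal.ofReal (V y) := by
    refine (setLIntegral_le_lintegral _ _).trans ((lintegral_mono hVpt).trans_eq ?_)
    rw [lintegral_add_right' _ ((aemeasurable_indicator_iff hK.measurableSet).2 hVK),
      lintegral_indicator (hQ.diff hF), lintegral_indicator hK.measurableSet,
      lintegral_const_mul' _ _ ENNReal.ofReal_ne_top]
  have hG : ∫⁻ y in Ω, ENNReal.ofReal (∑ j, ‖magD a φ j y‖ ^ 2) ≤ energy Q a (fun _ => 0) φ := by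
    refine (setLIntegral_le_lintegral _ _).trans ?_
    rw [energy, ← lintegral_indicator hQ]
    refine lintegral_mono fun y => ?_
    by_cases h : y ∈ Q
    · simp [Set.indicator_of_mem h]
    · have h' : y ∉ tsupport φ := fun h' => h (hφQ h')
      simp [magD_eq_zero_of_notMem_tsupport a h']
  have hm : AEMeasurable (fun y => ENNReal.ofReal (∑ j, ‖magD a φ j y‖ ^ 2))
      (volume.restrict Ω) :=
    (Finset.aemeasurable_fun_sum _ fun j _ =>
      (P.memLp_magD hφ j).1.norm.aemeasurable.pow_const 2).ennreal_ofReal.restrict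
  calc energy Ω a V φ ≤ ∫⁻ y in Ω, (ENNReal.ofReal (∑ j, ‖magD a φ j y‖ ^ 2) +
        ENNReal.ofReal (V y * ‖φ y‖ ^ 2)) := lintegral_mono fun y => ENNReal.ofReal_add_le
    _ = _ := lintegral_add_left' hm _
    _ ≤ _ := add_le_add hG hV

/-- Failure of the criterion on one cube yields a test function with Rayleigh quotient of order
`d^{-2}`. It combines the truncated almost minimiser of the local energy, the factor `1 - g` that
switches off `V` on `F`, and a spatial cutoff. -/
theorem exists_test_of_criterion_lt (hn : 2 ≤ n) : ∃ cn ct C c : ℝ, 0 < cn ∧ cn < 1 ∧ 0 < ct ∧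
    0 < C ∧ 0 < c ∧ ∀ (Ω : Set (E n)) (a : E n → E n) (V : E n → ℝ) (x : E n) (d : ℝ),
      FormData Ω a V → 0 < d → criterion Ω a V cn d x < ENNReal.ofReal (ct / d ^ 2) →
      ∃ φ : E n → ℂ, IsTest Ω φ ∧ energy Ω a V φ ≤ ENNReal.ofReal (C * (d ^ n / d ^ 2)) ∧
        ENNReal.ofReal (c * d ^ n) ≤ ∫⁻ y in Ω, ENNReal.ofReal (‖φ y‖ ^ 2) := by
  obtain ⟨Cχ, hCχ, hcut⟩ := exists_cutoff n
  obtain ⟨Cc, hCc, hcapQ⟩ := cap_cube_le n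
  obtain ⟨CL, hCL, hL⟩ := lintegral_sq_cube_le_dirichlet hn
  have hn0 : (0 : ℝ) < n := by exact_mod_cast (by omega : 0 < n)
  set p : ℝ := n * 2 ^ n with hp
  have hp0 : 0 < p := by positivity
  -- `cn` and `ct` are chosen so that the points where `g` is large, and those where `|u|` is far
  -- from `κ`, each cost at most a quarter of the volume `(d/2)^n`. The remaining half gives `c =
  -- 1/(136 · 2^n)`, as `136 = 2 · 68`.
  set cn : ℝ := min (1 / 2) (1 / (32 * 2 ^ n * CL * Cc)) with hcn
  set ct : ℝ := 1 / (64 * 2 ^ n * p) with hct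
  have hcn0 : 0 < cn := by positivity
  have hcn1 : cn < 1 := (min_le_left _ _).trans_lt (by norm_num)
  have hcnL : cn * (32 * 2 ^ n * CL * Cc) ≤ 1 := by
    rw [← le_div_iff₀ (by positivity)]; exact min_le_right _ _
  have hct0 : 0 < ct := by positivity
  have hctp : ct * (64 * 2 ^ n * p) = 1 := by rw [hct]; field_simp
  have h2n : (1 : ℝ) ≤ 2 ^ n := one_le_pow₀ (by norm_num)
  have hctp4 : 4 * (p * ct) ≤ 1 := by nlinarith [mul_pos hp0 hct0]
  refine ⟨cn, ct, 4 * n * (2 * Cχ) ^ 2 + 8 * cn * Cc + 8 * ct + (ct + 1), 1 / (136 * 2 ^ n), hcn0,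
    hcn1, hct0, by positivity, by positivity, fun Ω a V x d P hd hcr => ?_⟩
  set Q := cube x d with hQ
  have hQm : MeasurableSet Q := measurableSet_cube x d
  have hvolQ : volume Q = ENNReal.ofReal (d ^ n) := volume_cube x hd.le
  have hdn : 0 < d ^ n := by positivity
  -- the almost minimisers `u` of the local energy and `F` of the Molchanov functional
  have hloc : localEnergy Ω x d a < ENNReal.ofReal (ct / d ^ 2) := le_self_add.trans_lt hcr
  have hmol : molchanov Ω cn x d V < ENNReal.ofReal (ct * (d ^ n / d ^ 2)) := by
    have h1 : ENNReal.ofReal ((d ^ n)⁻¹) * molchanov Ω cn x d V < ENNReal.ofReal (ct / d ^ 2) :=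
      le_add_self.trans_lt hcr
    have h2 : ENNReal.ofReal (ct / d ^ 2) =
        ENNReal.ofReal ((d ^ n)⁻¹) * ENNReal.ofReal (ct * (d ^ n / d ^ 2)) := by
      rw [← ENNReal.ofReal_mul (by positivity)]
      congr 1; field_simp
    rw [h2] at h1
    exact lt_of_mul_lt_mul_left' h1
  rw [localEnergy, neumannBottom] at hloc
  rw [molchanov] at hmol
  simp only [iInf_lt_iff] at hloc hmol
  obtain ⟨u, ⟨hu, hune, hu0⟩, hur⟩ := hloc
  obtain ⟨F, ⟨hFc, hFQ, hΩF, hFcap⟩, hFV⟩ := hmol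
  have huc : Continuous u := hu.continuous
  obtain ⟨N, hN0, hN⟩ : ∃ N : ℝ, 0 < N ∧
      ∫⁻ y in Q, ENNReal.ofReal (‖u y‖ ^ 2) = ENNReal.ofReal N := by
    have hne := lintegral_sq_cube_ne_zero huc hd hune
    have hnt : ∫⁻ y in Q, ENNReal.ofReal (‖u y‖ ^ 2) ≠ ⊤ := by
      have hi : IntegrableOn (fun y => ‖u y‖ ^ 2) Q :=
        (huc.norm.pow 2).continuousOn.integrableOn_compact (isCompact_cube x d)
      rw [← ofReal_integral_eq_lintegral_ofReal hi (Eventually.of_forall fun y => by positivity)]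
      exact ENNReal.ofReal_ne_top
    exact ⟨_, ENNReal.toReal_pos hne hnt, (ENNReal.ofReal_toReal hnt).symm⟩
  have hE : energy Q a (fun _ => 0) u ≤ ENNReal.ofReal (ct / d ^ 2 * N) := by
    rw [hN, ENNReal.div_lt_iff (Or.inl (by simpa using hN0)) (Or.inl ENNReal.ofReal_ne_top),
      ← ENNReal.ofReal_mul (by positivity)] at hur
    exact hur.le
  obtain ⟨κ, hκ0, hκ⟩ := exists_sq_norm_sub_le_energy a (hu.of_le (by simp)) x hd
  have hI : ∫⁻ y in Q, ENNReal.ofReal ((‖u y‖ - κ) ^ 2) ≤ ENNReal.ofReal (p * ct * N) := by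
    refine hκ.trans ?_
    rw [show p * ct * N = (n * 2 ^ n * d ^ 2) * (ct / d ^ 2 * N) by rw [hp]; field_simp,
      ENNReal.ofReal_mul (p := n * 2 ^ n * d ^ 2) (by positivity)]
    exact mul_le_mul_right hE _
  -- The truncation level is the root mean square of `u`; dividing the energy by `s²` turns it into
  -- `ct · d^{n-2}`.
  obtain ⟨s, hs, hsN⟩ : ∃ s : ℝ, 0 < s ∧ N = s ^ 2 * d ^ n := by
    refine ⟨Real.sqrt (N / d ^ n), Real.sqrt_pos.2 (by positivity), ?_⟩
    rw [Real.sq_sqrt (by positivity)]; field_simp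
  have hNle : N ≤ 2 * (p * ct * N) + 2 * κ ^ 2 * d ^ n := by
    rw [← ENNReal.ofReal_le_ofReal_iff (by positivity), ← hN]
    refine (lintegral_sq_norm_le huc Q κ).trans ?_
    rw [ENNReal.ofReal_add (by positivity) (by positivity),
      ENNReal.ofReal_mul (p := 2) (q := p * ct * N) (by norm_num),
      ENNReal.ofReal_mul (p := 2 * κ ^ 2) (by positivity), hvolQ]
    gcongr
  have hκN : N ≤ 4 * κ ^ 2 * d ^ n := by nlinarith
  have hsκ : s / 2 ≤ κ := by
    rw [hsN] at hκN
    have h1 : s ^ 2 ≤ 4 * κ ^ 2 := le_of_mul_le_mul_right hκN hdn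
    refine le_of_sq_le_sq (by linarith [(by ring : (s / 2) ^ 2 = s ^ 2 / 4)]) hκ0
  have hκpos : 0 < κ := by linarith
  -- the compact part of `Ω` where `u` lives
  have hK : IsCompact (tsupport u ∩ Q) := (isCompact_cube x d).inter_left (isClosed_tsupport u)
  have hKΩ : tsupport u ∩ Q ⊆ Ω := by
    rintro y ⟨hy, hyQ⟩
    by_contra hyΩ
    have : ∀ᶠ z in 𝓝 y, u z = 0 := nhds_le_nhdsSet (show y ∈ cube x d ∩ Ωᶜ from ⟨hyQ, hyΩ⟩) hu0
    exact (notMem_tsupport_iff_eventuallyEq.2 this) hy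
  obtain ⟨A, hA0, hA⟩ : ∃ A : ℝ, 0 ≤ A ∧
      ∫⁻ y in tsupport u ∩ Q, ENNReal.ofReal (V y) = ENNReal.ofReal A :=
    ⟨_, ENNReal.toReal_nonneg, (ENNReal.ofReal_toReal
      (P.integrableOn_compact hK hKΩ).lintegral_lt_top.ne).symm⟩
  -- The mollified potential is only at least `1 - δ` on `F`. This `δ` may depend on `V` and `u`,
  -- because the final bounds do not involve it.
  obtain ⟨δ, hδ0, hδA⟩ : ∃ δ : ℝ, 0 < δ ∧ δ ^ 2 * A ≤ d ^ n / d ^ 2 := by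
    refine ⟨Real.sqrt (d ^ n / d ^ 2 / (A + 1)), Real.sqrt_pos.2 (by positivity), ?_⟩
    rw [Real.sq_sqrt (by positivity), div_mul_eq_mul_div, div_le_iff₀ (by positivity)]
    gcongr
    linarith
  -- The factor 2 leaves room for the strict inequality needed to pick an almost minimising
  -- potential.
  have hcapF : cap x d F < ENNReal.ofReal (2 * cn * Cc * (d ^ n / d ^ 2)) := by
    refine (hFcap.trans (mul_le_mul_right (hcapQ x d hd) _)).trans_lt ?_
    rw [← ENNReal.ofReal_mul hcn0.le, ENNReal.ofReal_lt_ofReal_iff (by positivity)]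
    have : 0 < cn * Cc * (d ^ n / d ^ 2) := by positivity
    linarith
  obtain ⟨g, hg, hgc, hgs, hg0, hg1, hgF, hgd⟩ := exists_smooth_potential hcapF hδ0
  -- At scale `d/2` the cutoff is supported in the interior of `Q_d`, where alone `u` is controlled,
  -- and is 1 on the half-size cube, where the mass is measured.
  obtain ⟨χ, hχ, hχc, hχs, hχ0, hχ1, hχQ, hχd⟩ := hcut x (d / 2) (by positivity)
  rw [mul_div_cancel₀ d two_ne_zero] at hχs
  set φ : E n → ℂ := fun y => ((χ y * (1 - g y) : ℝ) : ℂ) * truncate u s y with hφdef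
  have hsχ : Function.support φ ⊆ Function.support χ := fun y hy h => by simp [hφdef, h] at hy
  have hsu : Function.support φ ⊆ Function.support u := fun y hy h => by
    simp [hφdef, truncate, h] at hy
  have htQ : tsupport φ ⊆ Q := ((closure_mono hsχ).trans hχs).trans (openCube_subset_cube _ _)
  have htK : tsupport φ ⊆ tsupport u ∩ Q := Set.subset_inter (closure_mono hsu) htQ
  have hφ : IsTest Ω φ :=
    { smooth := (Complex.ofRealCLM.contDiff.comp (hχ.mul (contDiff_const.sub hg))).mul
        (contDiff_truncate hu hs)
      compactSupport := hχc.mono hsχ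
      support_subset := htK.trans hKΩ }
  have hnorm : ∀ y, ‖φ y‖ ≤ 1 - g y := by
    intro y
    have h1 : 0 ≤ 1 - g y := by linarith [hg1 y]
    simp only [hφdef]
    rw [norm_mul, Complex.norm_real, Real.norm_of_nonneg (mul_nonneg (hχ0 y) h1)]
    calc χ y * (1 - g y) * ‖truncate u s y‖ ≤ 1 * (1 - g y) * 1 := by
          gcongr
          · exact hχ1 y
          · exact norm_truncate_le_one hs y
      _ = _ := by ring
  refine ⟨φ, hφ, ?_, ?_⟩
  · refine (P.energy_le_of_bounds (δ := δ) hφ hQm hFc.measurableSet hK hKΩ htQ htK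
      (fun y => (hnorm y).trans (by linarith [hg0 y]))
      (fun y hy => (hnorm y).trans (by linarith [hgF y hy]))).trans ?_
    have he := energy_cutoff_truncate_le a (Q := Q) hu hχ hg hs hχ0 hχ1 hg0 hg1 hχd
    have b1 : ENNReal.ofReal (8 / s ^ 2) * energy Q a (fun _ => 0) u ≤
        ENNReal.ofReal (8 * ct * (d ^ n / d ^ 2)) := by
      refine (mul_le_mul_right hE _).trans ?_
      rw [← ENNReal.ofReal_mul (by positivity)]
      refine ENNReal.ofReal_le_ofReal (le_of_eq ?_)
      rw [hsN]; field_simp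
    have b2 : ENNReal.ofReal 4 * dirichlet g ≤
        ENNReal.ofReal (8 * cn * Cc * (d ^ n / d ^ 2)) := by
      refine (mul_le_mul_right hgd.le _).trans ?_
      rw [← ENNReal.ofReal_mul (by norm_num)]
      exact ENNReal.ofReal_le_ofReal (le_of_eq (by ring))
    have b3 : ENNReal.ofReal (4 * n * (Cχ / (d / 2)) ^ 2) * volume Q ≤
        ENNReal.ofReal (4 * n * (2 * Cχ) ^ 2 * (d ^ n / d ^ 2)) := by
      rw [hvolQ, ← ENNReal.ofReal_mul (by positivity)]
      refine ENNReal.ofReal_le_ofReal (le_of_eq ?_)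
      field_simp
    have b4 : ENNReal.ofReal (δ ^ 2) * ∫⁻ y in tsupport u ∩ Q, ENNReal.ofReal (V y) ≤
        ENNReal.ofReal (d ^ n / d ^ 2) := by
      rw [hA, ← ENNReal.ofReal_mul (by positivity)]
      exact ENNReal.ofReal_le_ofReal hδA
    refine (add_le_add (he.trans (add_le_add (add_le_add b3 b2) b1))
      (add_le_add hFV.le b4)).trans (le_of_eq ?_)
    rw [← ENNReal.ofReal_add (by positivity) (by positivity),
      ← ENNReal.ofReal_add (by positivity) (by positivity),
      ← ENNReal.ofReal_add (by positivity) (by positivity),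
      ← ENNReal.ofReal_add (by positivity) (by positivity)]
    congr 1
    ring
  · refine le_trans ?_ (setLIntegral_sq_le_of_isTest P.isOpen hφ (cube x (d / 2)))
    have hsub : cube x (d / 2) ⊆ Q := cube_subset_cube x (by linarith)
    have hv := volume_le_lintegral_truncate (measurableSet_cube x (d / 2)) (φ := φ) huc
      hg.continuous hs hsκ fun y hy => by simp [hφdef, hχQ y hy]
    obtain ⟨M, hM0, hM⟩ : ∃ M : ℝ, 0 ≤ M ∧
        ∫⁻ y in cube x (d / 2), ENNReal.ofReal (‖φ y‖ ^ 2) = ENNReal.ofReal M :=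
      ⟨_, ENNReal.toReal_nonneg, (ENNReal.ofReal_toReal (hφ.lintegral_sq_ne_top _)).symm⟩
    have b1 : ENNReal.ofReal (4 / κ ^ 2) *
        ∫⁻ y in cube x (d / 2), ENNReal.ofReal ((‖u y‖ - κ) ^ 2) ≤
        ENNReal.ofReal (16 * (p * ct) * d ^ n) := by
      refine (mul_le_mul_right ((lintegral_mono_set hsub).trans hI) _).trans ?_
      rw [← ENNReal.ofReal_mul (by positivity)]
      refine ENNReal.ofReal_le_ofReal ?_
      calc 4 / κ ^ 2 * (p * ct * N) ≤ 4 / κ ^ 2 * (p * ct * (4 * κ ^ 2 * d ^ n)) := by gcongr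
        _ = _ := by field_simp; ring
    have b2 : ENNReal.ofReal 4 * ∫⁻ y in cube x (d / 2), ENNReal.ofReal (‖g y‖ ^ 2) ≤
        ENNReal.ofReal (8 * (CL * Cc * cn) * d ^ n) := by
      refine (mul_le_mul_right ((lintegral_mono_set hsub).trans
        ((hL x d hd g (hg.of_le (by simp)) hgc hgs).trans (mul_le_mul_right hgd.le _))) _).trans ?_
      rw [← ENNReal.ofReal_mul (by positivity), ← ENNReal.ofReal_mul (by norm_num)]
      refine ENNReal.ofReal_le_ofReal (le_of_eq ?_)
      field_simp; ring
    rw [hM] at hv ⊢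
    have hv2 : ENNReal.ofReal ((d / 2) ^ n) ≤ ENNReal.ofReal (68 * M +
        (16 * (p * ct) * d ^ n + 8 * (CL * Cc * cn) * d ^ n)) := by
      rw [← volume_cube x (by positivity : 0 ≤ d / 2)]
      refine (hv.trans (add_le_add_right (add_le_add b1 b2) _)).trans (le_of_eq ?_)
      rw [← ENNReal.ofReal_mul (by norm_num), ← ENNReal.ofReal_add (by positivity) (by positivity),
        ← ENNReal.ofReal_add (by positivity) (by positivity)]
    rw [ENNReal.ofReal_le_ofReal_iff (by positivity), div_pow] at hv2
    refine ENNReal.ofReal_le_ofReal ?_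
    have k1 : 16 * (p * ct) * d ^ n = d ^ n / 2 ^ n / 4 := by
      rw [hct]; field_simp; norm_num
    have k2 : 8 * (CL * Cc * cn) * d ^ n ≤ d ^ n / 2 ^ n / 4 := by
      rw [div_div, le_div_iff₀ (by positivity)]
      calc 8 * (CL * Cc * cn) * d ^ n * (2 ^ n * 4) = cn * (32 * 2 ^ n * CL * Cc) * d ^ n := by ring
        _ ≤ 1 * d ^ n := by gcongr
        _ = _ := one_mul _
    have k3 : 1 / (136 * 2 ^ n) * d ^ n = d ^ n / 2 ^ n / 136 := by field_simp
    rw [k3]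
    linarith

/-- Strict positivity implies the lower bound for the criterion on all large cubes. -/
theorem exists_criterion_of_strictlyPositive (hn : 2 ≤ n) : ∃ cn ct : ℝ, 0 < cn ∧ cn < 1 ∧ 0 < ct ∧
    ∀ (Ω : Set (E n)) (a : E n → E n) (V : E n → ℝ), FormData Ω a V → StrictlyPositive Ω a V →
      ∃ d₂ : ℝ, 0 < d₂ ∧ ∀ d : ℝ, d₂ < d → ∀ x : E n,
        ENNReal.ofReal (ct / d ^ 2) ≤ criterion Ω a V cn d x := by
  obtain ⟨cn, ct, C, c, hcn, hcn1, hct, hC, hc, H⟩ := exists_test_of_criterion_lt hn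
  refine ⟨cn, ct, hcn, hcn1, hct, fun Ω a V P hpos => ?_⟩
  obtain ⟨ε, hε, hform⟩ := P.strictlyPositive_iff.1 hpos
  -- The test function gives `ε c d^n ≤ C d^{n-2}`, which is impossible once `d² > C/(ε c)`.
  refine ⟨Real.sqrt (C / (ε * c)), Real.sqrt_pos.2 (by positivity), fun d hd x => ?_⟩
  have hd0 : 0 < d := (Real.sqrt_nonneg _).trans_lt hd
  by_contra! hlt
  obtain ⟨φ, hφ, hen, hmass⟩ := H Ω a V x d P hd0 hlt
  have h1 := (mul_le_mul_right hmass (ENNReal.ofReal ε)).trans ((hform φ hφ).trans hen)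
  rw [← ENNReal.ofReal_mul hε.le, ENNReal.ofReal_le_ofReal_iff (by positivity)] at h1
  have h2 : C / (ε * c) < d ^ 2 := (Real.sqrt_lt' hd0).1 hd
  rw [div_lt_iff₀ (by positivity)] at h2
  rw [mul_div_assoc', le_div_iff₀ (by positivity)] at h1
  have hdn : 0 < d ^ n := by positivity
  nlinarith

end MagneticSchrodinger

end

/-! ### The equivalence -/

theorem theoremT (n : ℕ) (hn : 2 ≤ n) :
    ∃ cn ctn : ℝ, 0 < cn ∧ cn < 1 ∧ 0 < ctn ∧
      ∀ (Ω : Set (MagneticSchrodinger.E n)) (a : MagneticSchrodinger.E n → MagneticSchrodinger.E n)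
        (V : MagneticSchrodinger.E n → ℝ),
        IsOpen Ω →
        (∀ K : Set (MagneticSchrodinger.E n), IsCompact K → K ⊆ Ω →
          MemLp a 2 ((volume : Measure (MagneticSchrodinger.E n)).restrict K)) →
        LocallyIntegrableOn V Ω (volume : Measure (MagneticSchrodinger.E n)) →
        (∀ᵐ x ∂((volume : Measure (MagneticSchrodinger.E n)).restrict Ω), 0 ≤ V x) →
        List.TFAE [
          MagneticSchrodinger.StrictlyPositive Ω a V,
          ∃ c d₁ d : ℝ, 0 < c ∧ c < 1 ∧ 0 < d₁ ∧ 0 < d ∧ ∀ x : MagneticSchrodinger.E n,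
            ENNReal.ofReal (1 / d₁ ^ 2) ≤ MagneticSchrodinger.criterion Ω a V c d x,
          ∃ d₁ d : ℝ, 0 < d₁ ∧ 0 < d ∧ ∀ x : MagneticSchrodinger.E n,
            ENNReal.ofReal (1 / d₁ ^ 2) ≤ MagneticSchrodinger.criterion Ω a V cn d x,
          ∃ c ct d₂ : ℝ, 0 < c ∧ c < 1 ∧ 0 < ct ∧ 0 < d₂ ∧
            ∀ d : ℝ, d₂ < d → ∀ x : MagneticSchrodinger.E n,
              ENNReal.ofReal (ct / d ^ 2) ≤ MagneticSchrodinger.criterion Ω a V c d x,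
          ∃ d₂ : ℝ, 0 < d₂ ∧ ∀ d : ℝ, d₂ < d → ∀ x : MagneticSchrodinger.E n,
            ENNReal.ofReal (ctn / d ^ 2) ≤ MagneticSchrodinger.criterion Ω a V cn d x] := by
  obtain ⟨cn, ct, hcn, hcn1, hct, H⟩ :=
    MagneticSchrodinger.exists_criterion_of_strictlyPositive (n := n) hn
  refine ⟨cn, ct, hcn, hcn1, hct, fun Ω a V hΩ ha hV hV0 => ?_⟩
  have P : MagneticSchrodinger.FormData Ω a V := ⟨hΩ, ha, hV, hV0⟩
  -- Taking `d₁ = d/√c` rewrites a bound `c/d²` as `1/d₁²`; the large-scale conditions are then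
  -- specialised to the single scale `d₂ + 1`.
  have hscale : ∀ c d : ℝ, 0 < c → 0 < d → 0 < d / Real.sqrt c ∧
      1 / (d / Real.sqrt c) ^ 2 = c / d ^ 2 := fun c d hc hd =>
    ⟨div_pos hd (Real.sqrt_pos.2 hc), by rw [div_pow, Real.sq_sqrt hc.le, one_div_div]⟩
  tfae_have 1 → 5 := H Ω a V P
  tfae_have 5 → 4 := fun ⟨d₂, hd₂, h⟩ => ⟨cn, ct, d₂, hcn, hcn1, hct, hd₂, h⟩
  tfae_have 5 → 3 := by
    rintro ⟨d₂, hd₂, h⟩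
    obtain ⟨h1, h2⟩ := hscale ct (d₂ + 1) hct (by linarith)
    exact ⟨_, d₂ + 1, h1, by linarith, fun x => h2 ▸ h _ (by linarith) x⟩
  tfae_have 3 → 2 := fun ⟨d₁, d, hd₁, hd, h⟩ => ⟨cn, d₁, d, hcn, hcn1, hd₁, hd, h⟩
  tfae_have 4 → 2 := by
    rintro ⟨c, c', d₂, hc, hc1, hc', hd₂, h⟩
    obtain ⟨h1, h2⟩ := hscale c' (d₂ + 1) hc' (by linarith)
    exact ⟨c, _, d₂ + 1, hc, hc1, h1, by linarith, fun x => h2 ▸ h _ (by linarith) x⟩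
  tfae_have 2 → 1 := by
    rintro ⟨c, d₁, d, hc, -, hd₁, hd, h⟩
    exact MagneticSchrodinger.strictlyPositive_of_criterion hn P hc hd hd₁ h
  tfae_finish
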